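/- **Setting.** For a finite string $x=(x_1,\dots,x_m)$ of zeros and ones, read cyclically ($x_0:=x_m$), let $f_0(x)=\sum_n x_n$ and $f_1(x)=\#\{1\le n\le m: x_{n-1}=1,\ x_n=0\}$; let $H(x)$ be the string obtained from $x$ by removing all consecutive pairs $(1,0)$, including the pair $(x_m,x_1)$ if relevant, and for $k\ge 2$ let $f_k(x)=f_1(H^{k-1}(x))$ (the number of solitons of size at least $k$). For $\beta=(\beta_k)_{k\ge 0}$ in $\mathbb{R}\cup\{\infty\}$ and $N\ge 1$, the periodic Gibbs configuration $\eta^N=(\eta^N_n)_{n\in\mathbb{Z}}$ with parameters $\beta$ is the cyclic repetition of the random string with $$\mathbf{P}\big((\eta^N_n)_{n=1}^N=x\big)=\frac1Z\exp\Big(-\sum_{k\ge 0}\beta_k f_k(x)\Big)\mathbf{1}_{\{f_0(x)<N/2\}},\qquad x\in\{0,1\}^N,$$ where $Z$ is the normalising constant and $\infty\cdot 0:=0$. Convergence in distribution is that of random elements of $\{0,1\}^{\mathbb{Z}}$ with the product topology. **Proposition.** (a) Let $p\in(0,\frac12)$, and let $\eta^N$ have parameters $\beta_0=\log\frac{1-p}{p}$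 and $\beta_k=0$ for $k\ge1$. As $N\to\infty$, $\eta^N$ converges in distribution to the configuration $(\eta_n)_{n\in\mathbb{Z}}$ of i.i.d. Bernoulli($p$) random variables. (b) Let $p_0,p_1\in(0,1)$ with $p_0+p_1<1$, and let $\eta^N$ have parameters $\beta_0=\log\frac{1-p_0}{p_1}$, $\beta_1=\log\frac{p_1(1-p_0)}{p_0(1-p_1)}$ and $\beta_k=0$ for $k\ge2$. The two-sided stationary Markov chain $(\eta_n)_{n\in\mathbb{Z}}$ on $\{0,1\}$ with $\mathbf{P}(\eta_{n+1}=1\mid\eta_n=j)=p_j$, $j\in\{0,1\}$, exists, and $\eta^N$ converges to it in distribution as $N\to\infty$. (c) Let $p\in(0,1)$ and $K\ge 1$, and let $\eta^N$ have parameters $\beta_0=\log\frac{1-p}{p}$, $\beta_k=0$ for $1\le k\le K$ and $\beta_k=\infty$ for $k>K$. Let $P^{(K)}$ be the matrix on $\{0,\dots,K\}$ with $P^{(K)}(x,x+1)=p$ for $0\le x<K$, $P^{(K)}(x,x-1)=1-p$ for $1\le x\le K$, $P^{(K)}(0,0)=1-p$, and all other entries zero. Let $\lambda_K$ be the largest magnitude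 of its eigenvalues, $h_K$ a strictly positive eigenvector for the eigenvalue $\lambda_K$ (unique up to scaling), and $$\tilde P^{(K)}(x,y)=\frac{P^{(K)}(x,y)h_K(y)}{\lambda_K h_K(x)}.$$ Let $(\tilde W^{(K)}_n)_{n\in\mathbb{Z}}$ be the two-sided stationary Markov chain on $\{0,\dots,K\}$ with transition matrix $\tilde P^{(K)}$, and let $\tilde\eta^{(K)}_n=\mathbf{1}_{\{\tilde W^{(K)}_n-\tilde W^{(K)}_{n-1}=1\}}$, $n\in\mathbb{Z}$. These objects exist, and $\eta^N$ converges in distribution to $\tilde\eta^{(K)}$ as $N\to\infty$. -/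

import Mathlib

open MeasureTheory ProbabilityTheory Filter Topology
open scoped ENNReal

namespace BoxBall

noncomputable section

/-! ### Soliton counts of a cyclic configuration

A cyclic configuration `(x_1, …, x_m)` of zeros and ones is a list, read cyclically. -/

/-- The list of cyclic predecessors `(x_m, x_1, …, x_{m-1})`. -/
def cyclicPred (l : List (Fin 2)) : List (Fin 2) := l.rotate (l.length - 1)

/-- The list of cyclic successors `(x_2, …, x_m, x_1)`. -/
def cyclicSucc (l : List (Fin 2)) : List (Fin 2) := l.rotate 1

/-- The number of sites `n` with `x_{n-1} = 1` and `x_n = 0`, where `x_0 := x_m`. -/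
def countOneZero (l : List (Fin 2)) : ℕ := ((cyclicPred l).zip l).count (1, 0)

/-- Remove all (cyclically) consecutive pairs `(1, 0)`, including `(x_m, x_1)` if relevant: a site
is removed if it is the `0` of such a pair or the `1` of such a pair. -/
def contract (l : List (Fin 2)) : List (Fin 2) :=
  ((cyclicPred l).zip (l.zip (cyclicSucc l))).filterMap fun t =>
    if (t.1 = 1 ∧ t.2.1 = 0) ∨ (t.2.1 = 1 ∧ t.2.2 = 0) then none else some t.2.1

/-- `solitonCount 0` is the number of particles; for `k ≥ 1`, `solitonCount k` is the number of
solitons of size at least `k`, that is the number of pairs `(1, 0)` left after `k - 1`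
contractions. -/
def solitonCount : ℕ → List (Fin 2) → ℕ
  | 0, l => l.count 1
  | k + 1, l => countOneZero (contract^[k] l)

/-! ### The periodic Gibbs measure -/

/-- `exp (-e)` for an energy `e ∈ ℝ ∪ {∞}`, with `exp (-∞) = 0`. -/
def boltzmann (e : WithTop ℝ) : ℝ≥0∞ :=
  WithTop.recTopCoe (C := fun _ => ℝ≥0∞) 0 (fun r : ℝ => ENNReal.ofReal (Real.exp (-r))) e

/-- The unnormalised Gibbs weight `exp (- ∑ₖ βₖ fₖ(x)) 1{f₀(x) < N/2}` of `x ∈ {0,1}^N`, where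
`fₖ = solitonCount k`. The index `i : Fin N` is site `i + 1`. Only finitely many terms of the sum
are nonzero, and `0 • ∞ = 0`. -/
def gibbsWeight (β : ℕ → WithTop ℝ) (N : ℕ) (x : Fin N → Fin 2) : ℝ≥0∞ :=
  if (solitonCount 0 (List.ofFn x) : ℝ) < (N : ℝ) / 2 then
    boltzmann (∑ᶠ k : ℕ, solitonCount k (List.ofFn x) • β k)
  else 0

lemma mem_of_mem_contract {l : List (Fin 2)} {a : Fin 2} (h : a ∈ contract l) : a ∈ l := by
  unfold contract at h
  rw [List.mem_filterMap] at h
  obtain ⟨⟨b, c, d⟩, hm, hs⟩ := h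
  have h1 := (List.of_mem_zip (List.of_mem_zip hm).2).1
  split_ifs at hs
  simp only [Option.some.injEq] at hs
  exact hs ▸ h1

lemma mem_of_mem_iterate_contract (k : ℕ) {l : List (Fin 2)} {a : Fin 2}
    (h : a ∈ contract^[k] l) : a ∈ l := by
  induction k with
  | zero => exact h
  | succ k ih =>
    rw [Function.iterate_succ_apply'] at h
    exact ih (mem_of_mem_contract h)

lemma solitonCount_eq_zero (k : ℕ) {l : List (Fin 2)} (h : (1 : Fin 2) ∉ l) :
    solitonCount k l = 0 := by
  cases k with
  | zero => exact List.count_eq_zero.2 h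
  | succ k =>
    refine List.count_eq_zero.2 fun hm => h (mem_of_mem_iterate_contract k ?_)
    exact List.mem_rotate.1 (List.of_mem_zip hm).1

lemma gibbsWeight_zero (β : ℕ → WithTop ℝ) (N : ℕ+) : gibbsWeight β N (fun _ => 0) = 1 := by
  have h0 : ∀ k, solitonCount k (List.ofFn (fun _ : Fin N => (0 : Fin 2))) = 0 := fun k =>
    solitonCount_eq_zero k (by simp)
  have hN : (0 : ℝ) < (N : ℕ) := by exact_mod_cast N.pos
  have hb : boltzmann ((0 : ℝ) : WithTop ℝ) = 1 := by
    simp only [boltzmann, WithTop.recTopCoe_coe, neg_zero, Real.exp_zero, ENNReal.ofReal_one]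
  simp only [gibbsWeight, h0, zero_smul, finsum_zero, Nat.cast_zero]
  rw [if_pos (by positivity)]
  exact hb

lemma gibbsWeight_ne_top (β : ℕ → WithTop ℝ) (N : ℕ) (x : Fin N → Fin 2) :
    gibbsWeight β N x ≠ ∞ := by
  unfold gibbsWeight
  split_ifs
  · induction (∑ᶠ k : ℕ, solitonCount k (List.ofFn x) • β k) using WithTop.recTopCoe with
    | top => simp [boltzmann]
    | coe r => simp [boltzmann]
  · simp

/-- The Gibbs measure on `{0,1}^N` with parameters `β`. -/
def gibbsPMF (β : ℕ → WithTop ℝ) (N : ℕ+) : PMF (Fin N → Fin 2) :=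
  PMF.normalize (gibbsWeight β N)
    (fun h => by
      have := ENNReal.tsum_eq_zero.1 h (fun _ => 0)
      rw [gibbsWeight_zero] at this
      exact one_ne_zero this)
    (by
      rw [tsum_fintype]
      exact ENNReal.sum_ne_top.2 fun x _ => gibbsWeight_ne_top β N x)

/-- Cyclic repetition of `(x_1, …, x_N)`: the value at site `n ∈ ℤ` is `x_r`, where `1 ≤ r ≤ N` and
`r ≡ n` mod `N`. Since `x_r` has index `r - 1 : Fin N`, this index is `(n - 1) mod N`. -/
def cyclicExtension (N : ℕ+) (x : Fin N → Fin 2) : ℤ → Fin 2 := fun n =>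
  x ⟨((n - 1) % ((N : ℕ) : ℤ)).toNat, by
    have hN : (0 : ℤ) < ((N : ℕ) : ℤ) := by exact_mod_cast N.pos
    have h1 := Int.emod_nonneg (n - 1) hN.ne'
    have h2 := Int.emod_lt_of_pos (n - 1) hN
    omega⟩

/-- The law on `{0,1}^ℤ` of the `N`-periodic configuration obtained by cyclic repetition from the
Gibbs measure with parameters `β`. -/
def gibbsLaw (β : ℕ → WithTop ℝ) (N : ℕ+) : ProbabilityMeasure (ℤ → Fin 2) :=
  ⟨((gibbsPMF β N).map (cyclicExtension N)).toMeasure, inferInstance⟩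

/-- Parameters of the periodic i.i.d. configuration. -/
def iidParam (p : ℝ) : ℕ → WithTop ℝ
  | 0 => ((Real.log ((1 - p) / p) : ℝ) : WithTop ℝ)
  | _ + 1 => 0

/-- Parameters of the periodic Markov configuration. -/
def markovParam (p₀ p₁ : ℝ) : ℕ → WithTop ℝ
  | 0 => ((Real.log ((1 - p₀) / p₁) : ℝ) : WithTop ℝ)
  | 1 => ((Real.log (p₁ * (1 - p₀) / (p₀ * (1 - p₁))) : ℝ) : WithTop ℝ)
  | _ + 2 => 0

/-- Parameters of the periodic bounded soliton configuration. -/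
def boundedParam (p : ℝ) (K : ℕ) (k : ℕ) : WithTop ℝ :=
  if k = 0 then ((Real.log ((1 - p) / p) : ℝ) : WithTop ℝ) else if k ≤ K then 0 else ⊤

/-! ### The infinite-volume configurations -/

/-- The law of an i.i.d. Bernoulli(`p`) configuration. -/
def iidLaw (p : unitInterval) : ProbabilityMeasure (ℤ → Fin 2) :=
  ⟨Measure.infinitePi fun _ : ℤ => bernoulliMeasure (1 : Fin 2) 0 p, inferInstance⟩

/-- `μ` is the law of a two-sided stationary Markov chain `(X_n)_{n ∈ ℤ}` on the finite set `S` with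
transition matrix `Q`: the law is invariant under the shift, and
`P(X_m = s₀, …, X_{m+n} = sₙ, X_{m+n+1} = t) = P(X_m = s₀, …, X_{m+n} = sₙ) Q(sₙ, t)`. -/
structure IsStationaryMarkovLaw {S : Type} [Fintype S] [MeasurableSpace S]
    (Q : Matrix S S ℝ) (μ : ProbabilityMeasure (ℤ → S)) : Prop where
  stationary : MeasurePreserving (fun (ω : ℤ → S) (n : ℤ) => ω (n + 1))
    (μ : Measure (ℤ → S)) (μ : Measure (ℤ → S))
  markov : ∀ (m : ℤ) (n : ℕ) (s : ℕ → S) (t : S),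
    (μ : Measure (ℤ → S)).real {ω | (∀ i ≤ n, ω (m + i) = s i) ∧ ω (m + n + 1) = t} =
      (μ : Measure (ℤ → S)).real {ω | ∀ i ≤ n, ω (m + i) = s i} * Q (s n) t

/-- The transition matrix on `{0,1}` with `P(0,1) = p₀` and `P(1,1) = p₁`. -/
def markovMatrix (p₀ p₁ : ℝ) : Matrix (Fin 2) (Fin 2) ℝ := !![1 - p₀, p₀; 1 - p₁, p₁]

/-- The transition probabilities on `ℕ` of the carrier process of an i.i.d. Bernoulli(`p`)
configuration. -/
def carrierTransition (p : ℝ) (x y : ℕ) : ℝ :=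
  if y = x + 1 then p else if x = y + 1 ∨ (x = 0 ∧ y = 0) then 1 - p else 0

/-- The restriction of the carrier transition matrix to `{0, …, K}`. -/
def carrierMatrix (p : ℝ) (K : ℕ) : Matrix (Fin (K + 1)) (Fin (K + 1)) ℝ :=
  Matrix.of fun x y => carrierTransition p x y

/-- The largest magnitude of a (complex) eigenvalue of the carrier matrix on `{0, …, K}`. -/
def carrierEigenvalue (p : ℝ) (K : ℕ) : ℝ :=
  (spectralRadius ℂ ((carrierMatrix p K).map (fun r : ℝ => (r : ℂ)))).toReal

/-- `h` is a strictly positive eigenvector of the carrier matrix on `{0, …, K}` for the eigenvalue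
of largest magnitude (it is unique up to scaling). -/
def IsCarrierEigenvector (p : ℝ) (K : ℕ) (h : Fin (K + 1) → ℝ) : Prop :=
  (∀ x, 0 < h x) ∧ (carrierMatrix p K).mulVec h = carrierEigenvalue p K • h

/-- The `h`-transform `P(x,y) h(y) / (λ h(x))` of the carrier matrix. -/
def transformedCarrierMatrix (p : ℝ) (K : ℕ) (h : Fin (K + 1) → ℝ) :
    Matrix (Fin (K + 1)) (Fin (K + 1)) ℝ :=
  Matrix.of fun x y => carrierMatrix p K x y * h y / (carrierEigenvalue p K * h x)

/-- The particle configuration associated with a carrier path `w`: there is a particle at `n`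
exactly when the carrier's load goes up by one at `n`. -/
def carrierToConfig (K : ℕ) (w : ℤ → Fin (K + 1)) : ℤ → Fin 2 := fun n =>
  if (w n : ℕ) = (w (n - 1) : ℕ) + 1 then 1 else 0

/-- `μ` is the law of the particle configuration whose carrier process is the two-sided stationary
Markov chain with transition matrix the `h`-transform of the carrier matrix on `{0, …, K}`. -/
def IsBoundedSolitonLaw (p : ℝ) (K : ℕ) (μ : ProbabilityMeasure (ℤ → Fin 2)) : Prop :=
  ∃ h : Fin (K + 1) → ℝ, IsCarrierEigenvector p K h ∧
    ∃ ν : ProbabilityMeasure (ℤ → Fin (K + 1)),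
      IsStationaryMarkovLaw (transformedCarrierMatrix p K h) ν ∧
        (μ : Measure (ℤ → Fin 2)) = (ν : Measure (ℤ → Fin (K + 1))).map (carrierToConfig K)

end

end BoxBall

namespace BoxBall

noncomputable section

open scoped Matrix

/-! In all three cases the Gibbs weight of a word `x` with fewer ones than zeros is a constant
depending on `N` times the trace of `M x_1 ⋯ M x_N`. Here `M z` collects the transitions with output
`z` of a stochastic matrix `P = M 0 + M 1` having a positive power. For the Markov case the output
is the new state, and the closed path read off from `x` has a probability that depends only on `N`,
the number of ones and the number of pairs `(1, 0)` (`gibbsWeight_markovParam`); equal parameters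
give the i.i.d. case.

For bounded solitons `P` is the `h`-transformed carrier and the output records a step up. A word
with more zeros than ones has exactly one cyclic carrier path, and that path stays below `K` if and
only if no soliton exceeds size `K` (`solitonCount_succ_eq_zero_iff`): each contraction cuts every
peak of the carrier by one. So the trace carries the infinite energies as well
(`gibbsWeight_boundedParam`).

Ignoring the constraint on the number of ones, the words starting with `l` have total weight `tr
(M_l P^(N - |l|))`, which tends to `∑ b, (π M_l) b` because the powers of `P` converge to rows `π`.
The constraint costs nothing in the limit. On the excluded words the factor `θ^(#1 - #0)` is at
least one, so their total weight is at most `tr (θ⁻¹ M 0 + θ M 1)^N`; this decays geometrically once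
a positive vector `v` satisfies `B v ≤ ρ v` with `ρ < 1`, where `B` is the tilted matrix. Dividing
by the partition function gives all cylinder probabilities (`tendsto_periodize_cyl`), hence weak
convergence (`tendsto_gibbsLaw`).

The outputs of a stationary chain with matrix `P` have the same cylinder formula
(`IsStationaryMarkovLaw.map_outputPath_cyl`). Such a chain exists because the unconstrained periodic
laws have a cluster point by compactness (`exists_law_cyl`). -/

/-! ### Powers of stochastic matrices and a bound on traces of powers. -/

lemma pow_mulVec_one {S : Type*} [Fintype S] [DecidableEq S] {P : Matrix S S ℝ}
    (h1 : ∀ a, ∑ b, P a b = 1) (n : ℕ) (a : S) : ∑ b, (P ^ n) a b = 1 := by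
  induction n generalizing a with
  | zero => simp [Matrix.one_apply]
  | succ n ih =>
    simp only [pow_succ, Matrix.mul_apply]
    rw [Finset.sum_comm]
    simp [← Finset.mul_sum, h1, ih]

/-- One step of Doeblin's contraction: averaging a function with values in `[l, u]` against two
probability vectors with entries at least `ε` gives values at distance at most `(1 - ε) (u - l)`. -/
lemma sum_mul_sub_sum_mul_le {S : Type*} [Fintype S] {v w f : S → ℝ} {l u ε : ℝ}
    (hv : ∑ a, v a = 1) (hw : ∑ a, w a = 1) (hε : ∀ a, ε ≤ v a) (hε' : ∀ a, ε ≤ w a)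
    (hl : ∀ a, l ≤ f a) (hu : ∀ a, f a ≤ u) :
    ∑ a, v a * f a - ∑ a, w a * f a ≤ (1 - Fintype.card S * ε) * (u - l) := by
  have e1 : ∑ a, (v a - ε) * f a ≤ ∑ a, (v a - ε) * u :=
    Finset.sum_le_sum fun a _ => mul_le_mul_of_nonneg_left (hu a) (sub_nonneg.2 (hε a))
  have e2 : ∑ a, (w a - ε) * l ≤ ∑ a, (w a - ε) * f a :=
    Finset.sum_le_sum fun a _ => mul_le_mul_of_nonneg_left (hl a) (sub_nonneg.2 (hε' a))
  simp only [sub_mul, Finset.sum_sub_distrib, ← Finset.sum_mul, hv, hw, Finset.sum_const,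
    Finset.card_univ, nsmul_eq_mul] at e1 e2
  linarith

/-- The powers of a stochastic matrix with a positive power converge to a matrix with equal rows. -/
theorem tendsto_pow_of_stochastic {S : Type*} [Fintype S] [DecidableEq S] [Nonempty S]
    {P : Matrix S S ℝ} (h0 : ∀ a b, 0 ≤ P a b) (h1 : ∀ a, ∑ b, P a b = 1)
    {m : ℕ} (hm : ∀ a b, 0 < (P ^ m) a b) :
    ∃ π : S → ℝ, ∀ a b, Tendsto (fun n => (P ^ n) a b) atTop (𝓝 (π b)) := by
  classical
  suffices H : ∀ b, ∃ c, ∀ a, Tendsto (fun n => (P ^ n) a b) atTop (𝓝 c) by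
    choose π hπ using H
    exact ⟨π, fun a b => hπ b a⟩
  intro b
  have hne : (Finset.univ : Finset S).Nonempty := Finset.univ_nonempty
  -- Largest and smallest entry of column `b` of `P ^ n`. Averaging lowers the first and raises the
  -- second, and every `m` steps shrink the gap by the factor `r`.
  let U : ℕ → ℝ := fun n => Finset.univ.sup' hne fun a => (P ^ n) a b
  let D : ℕ → ℝ := fun n => Finset.univ.inf' hne fun a => (P ^ n) a b
  have hU : ∀ n a, (P ^ n) a b ≤ U n := fun n a =>
    Finset.le_sup' (fun a => (P ^ n) a b) (Finset.mem_univ a)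
  have hD : ∀ n a, D n ≤ (P ^ n) a b := fun n a =>
    Finset.inf'_le (fun a => (P ^ n) a b) (Finset.mem_univ a)
  have hUanti : Antitone U := antitone_nat_of_succ_le fun n => Finset.sup'_le _ _ fun a _ => by
    rw [pow_succ', Matrix.mul_apply]
    calc ∑ c, P a c * (P ^ n) c b ≤ ∑ c, P a c * U n :=
          Finset.sum_le_sum fun c _ => mul_le_mul_of_nonneg_left (hU n c) (h0 a c)
      _ = U n := by rw [← Finset.sum_mul, h1, one_mul]
  have hDmono : Monotone D := monotone_nat_of_le_succ fun n => Finset.le_inf' _ _ fun a _ => by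
    rw [pow_succ', Matrix.mul_apply]
    calc D n = ∑ c, P a c * D n := by rw [← Finset.sum_mul, h1, one_mul]
      _ ≤ ∑ c, P a c * (P ^ n) c b :=
          Finset.sum_le_sum fun c _ => mul_le_mul_of_nonneg_left (hD n c) (h0 a c)
  have hDU : ∀ n, D n ≤ U n := fun n => (hD n (Classical.arbitrary S)).trans (hU n _)
  obtain ⟨ε, hε, hεP⟩ : ∃ ε > 0, ∀ a b, ε ≤ (P ^ m) a b := by
    obtain ⟨x, -, hx⟩ := Finset.exists_min_image (Finset.univ : Finset (S × S))
      (fun x => (P ^ m) x.1 x.2) Finset.univ_nonempty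
    exact ⟨_, hm x.1 x.2, fun a b => hx (a, b) (Finset.mem_univ _)⟩
  set r : ℝ := 1 - Fintype.card S * ε with hr
  have hcard : (0 : ℝ) < Fintype.card S := by exact_mod_cast Fintype.card_pos
  have hr1 : r < 1 := by rw [hr]; nlinarith
  have hr0 : 0 ≤ r := by
    have := pow_mulVec_one h1 m (Classical.arbitrary S)
    have h2 : ∑ b : S, ε ≤ ∑ b, (P ^ m) (Classical.arbitrary S) b :=
      Finset.sum_le_sum fun c _ => hεP _ c
    rw [this, Finset.sum_const, Finset.card_univ, nsmul_eq_mul] at h2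
    linarith
  have hstep : ∀ n, U (m + n) - D (m + n) ≤ r * (U n - D n) := by
    intro n
    obtain ⟨x, -, hx⟩ := Finset.exists_mem_eq_sup' hne fun a => (P ^ (m + n)) a b
    obtain ⟨y, -, hy⟩ := Finset.exists_mem_eq_inf' hne fun a => (P ^ (m + n)) a b
    change U (m + n) = _ at hx
    change D (m + n) = _ at hy
    rw [hx, hy, pow_add, Matrix.mul_apply, Matrix.mul_apply]
    exact sum_mul_sub_sum_mul_le (pow_mulVec_one h1 m x) (pow_mulVec_one h1 m y)
      (hεP x) (hεP y) (hD n) (hU n)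
  have hgeom : ∀ k, U (m * k) - D (m * k) ≤ r ^ k * (U 0 - D 0) := by
    intro k
    induction k with
    | zero => simp
    | succ k ih =>
      rw [show m * (k + 1) = m + m * k by ring, pow_succ']
      nlinarith [hstep (m * k)]
  have hUlim : Tendsto U atTop (𝓝 (⨅ n, U n)) :=
    tendsto_atTop_ciInf hUanti ⟨D 0, by rintro _ ⟨n, rfl⟩; exact (hDmono n.zero_le).trans (hDU n)⟩
  have hDlim : Tendsto D atTop (𝓝 (⨆ n, D n)) :=
    tendsto_atTop_ciSup hDmono ⟨U 0, by rintro _ ⟨n, rfl⟩; exact (hDU n).trans (hUanti n.zero_le)⟩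
  have hle : (⨅ n, U n) - (⨆ n, D n) ≤ 0 := by
    refine ge_of_tendsto' (f := fun k : ℕ => r ^ k * (U 0 - D 0)) (x := atTop) ?_ fun k => ?_
    · simpa using (tendsto_pow_atTop_nhds_zero_of_lt_one hr0 hr1).mul_const (U 0 - D 0)
    · refine le_trans (sub_le_sub ?_ ?_) (hgeom k)
      · exact hUanti.le_of_tendsto hUlim _
      · exact hDmono.ge_of_tendsto hDlim _
  have hge : (⨆ n, D n) ≤ ⨅ n, U n := le_of_tendsto_of_tendsto' hDlim hUlim hDU
  have heq : (⨆ n, D n) = ⨅ n, U n := le_antisymm hge (by linarith)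
  exact ⟨_, fun a => tendsto_of_tendsto_of_tendsto_of_le_of_le (heq ▸ hDlim) hUlim
    (fun n => hD n a) (fun n => hU n a)⟩

/-- The limit of the powers of a stochastic matrix is an invariant probability vector, and the only
one. -/
lemma limit_of_stochastic {S : Type*} [Fintype S] [DecidableEq S] [Nonempty S]
    {P : Matrix S S ℝ} (h1 : ∀ a, ∑ b, P a b = 1) {π : S → ℝ}
    (hπ : ∀ a b, Tendsto (fun n => (P ^ n) a b) atTop (𝓝 (π b))) :
    ∑ b, π b = 1 ∧ π ᵥ* P = π ∧
      ∀ ρ : S → ℝ, ∑ b, ρ b = 1 → ρ ᵥ* P = ρ → ρ = π := by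
  have a₀ := Classical.arbitrary S
  refine ⟨?_, ?_, ?_⟩
  · refine tendsto_nhds_unique (tendsto_finsetSum _ fun b _ => hπ a₀ b) ?_
    simp [pow_mulVec_one h1]
  · ext b
    refine tendsto_nhds_unique (f := fun n => (P ^ (n + 1)) a₀ b) (l := atTop) ?_
      ((hπ a₀ b).comp (tendsto_add_atTop_nat 1))
    simp only [pow_succ, Matrix.mul_apply, Matrix.vecMul, dotProduct]
    exact tendsto_finsetSum _ fun c _ => (hπ a₀ c).mul_const _
  · intro ρ hρ hρP
    have hn : ∀ n, ρ ᵥ* P ^ n = ρ := fun n => by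
      induction n with
      | zero => simp
      | succ n ih => rw [pow_succ, ← Matrix.vecMul_vecMul, ih, hρP]
    ext b
    have : Tendsto (fun n => (ρ ᵥ* P ^ n) b) atTop (𝓝 (∑ a, ρ a * π b)) := by
      simp only [Matrix.vecMul, dotProduct]
      exact tendsto_finsetSum _ fun c _ => (hπ c b).const_mul _
    simp only [hn, ← Finset.sum_mul, hρ, one_mul] at this
    exact tendsto_nhds_unique tendsto_const_nhds this

/-- If `B v ≤ ρ v` for a positive vector `v`, then the trace of `B ^ N` is at most a multiple of
`ρ ^ N`. -/
lemma trace_pow_le {S : Type*} [Fintype S] [DecidableEq S] {B : Matrix S S ℝ} {v : S → ℝ} {ρ : ℝ}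
    (hB : ∀ a b, 0 ≤ B a b) (hv : ∀ a, 0 < v a) (hρ : 0 ≤ ρ)
    (h : ∀ a, (B *ᵥ v) a ≤ ρ * v a) (N : ℕ) :
    (B ^ N).trace ≤ Fintype.card S * ρ ^ N := by
  have hpow : ∀ a, ((B ^ N) *ᵥ v) a ≤ ρ ^ N * v a := by
    induction N with
    | zero => simp
    | succ n ih =>
      intro a
      rw [pow_succ', ← Matrix.mulVec_mulVec]
      calc (B *ᵥ (B ^ n *ᵥ v)) a ≤ ∑ b, B a b * (ρ ^ n * v b) :=
            Finset.sum_le_sum fun b _ => mul_le_mul_of_nonneg_left (ih b) (hB a b)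
        _ = ρ ^ n * (B *ᵥ v) a := by
            simp only [Matrix.mulVec, dotProduct, Finset.mul_sum]
            exact Finset.sum_congr rfl fun b _ => by ring
        _ ≤ ρ ^ n * (ρ * v a) := mul_le_mul_of_nonneg_left (h a) (pow_nonneg hρ n)
        _ = _ := by ring
  have hBN : ∀ a b, 0 ≤ (B ^ N) a b := fun a b => Matrix.pow_apply_nonneg hB N a b
  have hd : ∀ a, (B ^ N) a a ≤ ρ ^ N := fun a => by
    have : (B ^ N) a a * v a ≤ ρ ^ N * v a := le_trans
      (Finset.single_le_sum (f := fun b => (B ^ N) a b * v b)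
        (fun b _ => mul_nonneg (hBN a b) (hv b).le) (Finset.mem_univ a)) (hpow a)
    exact le_of_mul_le_mul_right this (hv a)
  calc (B ^ N).trace ≤ ∑ _a : S, ρ ^ N := Finset.sum_le_sum fun a _ => hd a
    _ = _ := by simp

/-! ### Matrix products along words -/

/-- The product of the matrices `M z` along a word. -/
def wordProd {S T : Type*} [Fintype S] [DecidableEq S] (M : T → Matrix S S ℝ) (l : List T) :
    Matrix S S ℝ := (l.map M).prod

section wordProd
variable {S T : Type*} [Fintype S] [DecidableEq S] (M : T → Matrix S S ℝ)

@[simp] lemma wordProd_nil : wordProd M [] = 1 := rfl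

@[simp] lemma wordProd_cons (z : T) (l : List T) : wordProd M (z :: l) = M z * wordProd M l := by
  simp [wordProd]

@[simp] lemma wordProd_append (l l' : List T) :
    wordProd M (l ++ l') = wordProd M l * wordProd M l' := by
  simp [wordProd]

lemma wordProd_nonneg {M : T → Matrix S S ℝ} (hM : ∀ z a b, 0 ≤ M z a b) (l : List T) (a b : S) :
    0 ≤ wordProd M l a b := by
  induction l generalizing a with
  | nil => simp only [wordProd_nil, Matrix.one_apply]; split_ifs <;> simp
  | cons z l ih =>
    rw [wordProd_cons, Matrix.mul_apply]
    exact Finset.sum_nonneg fun c _ => mul_nonneg (hM z a c) (ih c)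

/-- Rotation exchanges two blocks of the product, and the trace is cyclic. This reduces a cylinder
at any site to an event about prefixes. -/
lemma trace_wordProd_rotate (l : List T) (k : ℕ) :
    (wordProd M (l.rotate k)).trace = (wordProd M l).trace := by
  obtain ⟨u, v, hl, hr⟩ : ∃ u v, l = u ++ v ∧ l.rotate k = v ++ u :=
    ⟨_, _, (List.take_append_drop (k % l.length) l).symm, List.rotate_eq_drop_append_take_mod⟩
  rw [hr, hl, wordProd_append, wordProd_append, Matrix.trace_mul_comm]

lemma sum_wordProd [Fintype T] (N : ℕ) :
    ∑ x : Fin N → T, wordProd M (List.ofFn x) = (∑ z, M z) ^ N := by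
  induction N with
  | zero => simp
  | succ N ih =>
    rw [← (Fin.consEquiv fun _ => T).sum_comp, Fintype.sum_prod_type]
    simp [Fin.consEquiv, List.ofFn_succ, ← Finset.mul_sum, ih, ← Finset.sum_mul, pow_succ']

/-- The prefix contributes its own factors, and each free letter sums to the full matrix. -/
lemma sum_wordProd_of_prefix [Fintype T] [DecidableEq T] (l : List T) (N : ℕ)
    (hN : l.length ≤ N) :
    ∑ x : Fin N → T, (if l <+: List.ofFn x then wordProd M (List.ofFn x) else 0) =
      wordProd M l * (∑ z, M z) ^ (N - l.length) := by
  induction l generalizing N with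
  | nil => simp [sum_wordProd]
  | cons z l ih =>
    obtain ⟨N, rfl⟩ : ∃ n, N = n + 1 := ⟨N - 1, by simp at hN; omega⟩
    rw [← (Fin.consEquiv fun _ => T).sum_comp, Fintype.sum_prod_type,
      Finset.sum_eq_single z]
    · have := ih N (by simpa using hN)
      simp only [Fin.consEquiv, Equiv.coe_fn_mk, List.ofFn_cons, List.cons_prefix_cons, true_and,
        wordProd_cons, List.length_cons, Nat.add_sub_add_right, mul_assoc, ← this, Finset.mul_sum,
        mul_ite, mul_zero]
    · intro y _ hy
      refine Finset.sum_eq_zero fun x _ => ?_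
      simp [Fin.consEquiv, List.cons_prefix_cons, Ne.symm hy]
    · simp
end wordProd

/-! ### The Perron eigenvector -/

lemma mulVec_pos_of_pos {S : Type*} [Fintype S] {A : Matrix S S ℝ} (hA : ∀ a b, 0 < A a b)
    {x : S → ℝ} (hx : ∀ a, 0 ≤ x a) (hx0 : x ≠ 0) (a : S) : 0 < (A *ᵥ x) a := by
  obtain ⟨b, hb⟩ := Function.ne_iff.1 hx0
  exact Finset.sum_pos' (fun c _ => mul_nonneg (hA a c).le (hx c))
    ⟨b, Finset.mem_univ b, mul_pos (hA a b) ((hx b).lt_of_ne' hb)⟩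

/-- A nonnegative matrix with a positive power has a positive eigenvector. -/
theorem exists_pos_eigenvector {S : Type*} [Fintype S] [DecidableEq S] [Nonempty S]
    {P : Matrix S S ℝ} (h0 : ∀ a b, 0 ≤ P a b) {m : ℕ} (hm : ∀ a b, 0 < (P ^ m) a b) :
    ∃ (h : S → ℝ) (Λ : ℝ), 0 ≤ Λ ∧ (∀ a, 0 < h a) ∧ P *ᵥ h = Λ • h := by
  set T : ℝ := ∑ a, ∑ b, P a b with hT
  have hT0 : 0 ≤ T := Finset.sum_nonneg fun a _ => Finset.sum_nonneg fun b _ => h0 a b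
  -- Collatz–Wielandt: the eigenvalue is found as the largest `t` for which `t x ≤ P x` has a
  -- solution in the simplex.
  let D : Set (ℝ × (S → ℝ)) :=
    (Set.Icc 0 T ×ˢ stdSimplex ℝ S) ∩ {q | ∀ a, q.1 * q.2 a ≤ (P *ᵥ q.2) a}
  have hDc : IsCompact D := by
    refine (isCompact_Icc.prod (isCompact_stdSimplex ℝ S)).inter_right ?_
    have : {q : ℝ × (S → ℝ) | ∀ a, q.1 * q.2 a ≤ (P *ᵥ q.2) a} =
        ⋂ a, {q | q.1 * q.2 a ≤ (P *ᵥ q.2) a} := by ext; simp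
    rw [this]
    refine isClosed_iInter fun a => isClosed_le (by fun_prop) ?_
    simp only [Matrix.mulVec, dotProduct]
    fun_prop
  have hbound : ∀ (t : ℝ) (x : S → ℝ), x ∈ stdSimplex ℝ S → (∀ a, t * x a ≤ (P *ᵥ x) a) → t ≤ T := by
    intro t x hx h
    calc t = ∑ a, t * x a := by rw [← Finset.mul_sum, hx.2, mul_one]
      _ ≤ ∑ a, (P *ᵥ x) a := Finset.sum_le_sum fun a _ => h a
      _ ≤ T := by
        refine Finset.sum_le_sum fun a _ => Finset.sum_le_sum fun b _ => ?_
        have : x b ≤ 1 := by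
          rw [← hx.2]; exact Finset.single_le_sum (fun c _ => hx.1 c) (Finset.mem_univ b)
        nlinarith [h0 a b]
  have hDne : D.Nonempty := by
    obtain ⟨x, hx⟩ : (stdSimplex ℝ S).Nonempty :=
      ⟨_, single_mem_stdSimplex ℝ (Classical.arbitrary S)⟩
    refine ⟨(0, x), ⟨⟨le_refl _, hT0⟩, hx⟩, fun a => ?_⟩
    simp only [zero_mul]
    exact Finset.sum_nonneg fun b _ => mul_nonneg (h0 a b) (hx.1 b)
  obtain ⟨⟨Λ, x⟩, ⟨⟨⟨hΛ0, -⟩, hx⟩, hle⟩, hmax⟩ :=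
    hDc.exists_isMaxOn hDne (f := Prod.fst) (by fun_prop)
  simp only at hΛ0 hx hle
  have hx0 : x ≠ 0 := by
    rintro rfl
    simpa using hx.2
  have heig : P *ᵥ x = Λ • x := by
    by_contra hne
    set y : S → ℝ := P *ᵥ x - Λ • x with hy
    have hy0 : ∀ a, 0 ≤ y a := fun a => by
      simpa [hy] using hle a
    have hyne : y ≠ 0 := fun h => hne (sub_eq_zero.1 h)
    have hz := mulVec_pos_of_pos hm hx.1 hx0
    have hw := mulVec_pos_of_pos hm hy0 hyne
    set z := P ^ m *ᵥ x with hzdef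
    have hzw : P *ᵥ z - Λ • z = P ^ m *ᵥ y := by
      rw [hy, Matrix.mulVec_sub, Matrix.mulVec_smul, hzdef, Matrix.mulVec_mulVec,
        Matrix.mulVec_mulVec, ← pow_succ, ← pow_succ']
    obtain ⟨a₀, -, ha₀⟩ := Finset.exists_min_image (Finset.univ : Finset S)
      (fun a => (P ^ m *ᵥ y) a / z a) Finset.univ_nonempty
    set ε := (P ^ m *ᵥ y) a₀ / z a₀
    have hε : 0 < ε := div_pos (hw _) (hz _)
    have hs : 0 < ∑ a, z a := Finset.sum_pos (fun a _ => hz a) Finset.univ_nonempty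
    have hz1 : ∀ a, (Λ + ε) * z a ≤ (P *ᵥ z) a := fun a => by
      have h1 : ε ≤ (P ^ m *ᵥ y) a / z a := ha₀ a (Finset.mem_univ a)
      rw [le_div_iff₀ (hz a)] at h1
      have h2 := congrFun hzw a
      simp only [Pi.sub_apply, Pi.smul_apply, smul_eq_mul] at h2
      linarith
    have hmem : (∑ a, z a)⁻¹ • z ∈ stdSimplex ℝ S := by
      refine ⟨fun a => mul_nonneg (inv_nonneg.2 hs.le) (hz a).le, ?_⟩
      simp only [Pi.smul_apply, smul_eq_mul, ← Finset.mul_sum]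
      exact inv_mul_cancel₀ hs.ne'
    have hz2 : ∀ a, (Λ + ε) * ((∑ a, z a)⁻¹ • z) a ≤ (P *ᵥ ((∑ a, z a)⁻¹ • z)) a := fun a => by
      rw [Matrix.mulVec_smul]
      simp only [Pi.smul_apply, smul_eq_mul]
      nlinarith [mul_le_mul_of_nonneg_left (hz1 a) (inv_nonneg.2 hs.le)]
    have hm' := hmax (a := (Λ + ε, (∑ a, z a)⁻¹ • z))
      ⟨⟨⟨by positivity, hbound _ _ hmem hz2⟩, hmem⟩, hz2⟩
    simp only [Set.mem_ofPred_eq] at hm'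
    linarith
  -- A zero coordinate of `x` would also be one of `P ^ m x = Λ ^ m x`, which is positive.
  refine ⟨x, Λ, hΛ0, fun a => (hx.1 a).lt_of_ne' fun ha => ?_, heig⟩
  have hpow : ∀ n, P ^ n *ᵥ x = Λ ^ n • x := fun n => by
    induction n with
    | zero => simp
    | succ n ih => rw [pow_succ', ← Matrix.mulVec_mulVec, ih, Matrix.mulVec_smul, heig, smul_smul,
        pow_succ]
  have := mulVec_pos_of_pos hm hx.1 hx0 a
  simp [hpow, ha] at this

/-- The eigenvalue of a positive eigenvector of a nonnegative matrix is the spectral radius. -/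
theorem spectralRadius_eq_of_pos_eigenvector {S : Type*} [Fintype S] [DecidableEq S] [Nonempty S]
    {P : Matrix S S ℝ} (h0 : ∀ a b, 0 ≤ P a b) {h : S → ℝ} {Λ : ℝ} (hΛ : 0 ≤ Λ)
    (hh : ∀ a, 0 < h a) (hP : P *ᵥ h = Λ • h) :
    (spectralRadius ℂ (P.map (fun r : ℝ => (r : ℂ)))).toReal = Λ := by
  set A : Matrix S S ℂ := P.map (fun r : ℝ => (r : ℂ)) with hA
  have hmem : ∀ z : ℂ, z ∈ spectrum ℂ A ↔ ∃ v : S → ℂ, v ≠ 0 ∧ A *ᵥ v = z • v := by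
    intro z
    rw [← Matrix.spectrum_toLin', ← Module.End.hasEigenvalue_iff_mem_spectrum]
    constructor
    · intro hz
      obtain ⟨v, hv⟩ := hz.exists_hasEigenvector
      exact ⟨v, hv.2, by simpa using hv.apply_eq_smul⟩
    · rintro ⟨v, hv, h⟩
      exact Module.End.hasEigenvalue_of_hasEigenvector
        (Module.End.hasEigenvector_iff.2 ⟨Module.End.mem_eigenspace_iff.2 (by simpa using h), hv⟩)
  have hΛmem : (Λ : ℂ) ∈ spectrum ℂ A := by
    rw [hmem]
    refine ⟨fun a => (h a : ℂ), fun h' => ?_, ?_⟩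
    · have := congrFun h' (Classical.arbitrary S)
      simp only [Pi.zero_apply, Complex.ofReal_eq_zero] at this
      exact (hh _).ne' this
    · ext a
      have := congrFun hP a
      simp only [Matrix.mulVec, dotProduct, Pi.smul_apply, smul_eq_mul] at this
      simp only [Matrix.mulVec, dotProduct, hA, Matrix.map_apply, Pi.smul_apply, smul_eq_mul]
      exact_mod_cast this
  have hle : ∀ z ∈ spectrum ℂ A, ‖z‖ ≤ Λ := by
    intro z hz
    obtain ⟨v, hv, hzv⟩ := (hmem z).1 hz
    -- A maximum principle: the eigenvalue equation is estimated at a coordinate where `‖v‖ / h` is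
    -- largest.
    obtain ⟨a, -, ha⟩ := Finset.exists_max_image (Finset.univ : Finset S)
      (fun a => ‖v a‖ / h a) Finset.univ_nonempty
    set c := ‖v a‖ / h a
    have hvc : ∀ b, ‖v b‖ ≤ c * h b := fun b => by
      have := ha b (Finset.mem_univ b)
      rwa [div_le_iff₀ (hh b)] at this
    have hc : 0 < c := by
      obtain ⟨b, hb⟩ := Function.ne_iff.1 hv
      have h1 : 0 < ‖v b‖ := norm_pos_iff.2 hb
      have h2 := h1.trans_le (hvc b)
      exact pos_of_mul_pos_left h2 (hh b).le
    have hva : ‖v a‖ = c * h a := by simp [c, (hh a).ne']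
    have key : ‖z‖ * ‖v a‖ ≤ c * (Λ * h a) := by
      have e := congrFun hzv a
      simp only [Pi.smul_apply, smul_eq_mul] at e
      rw [← norm_mul, ← e]
      calc ‖(A *ᵥ v) a‖ ≤ ∑ b, ‖A a b * v b‖ := norm_sum_le _ _
        _ = ∑ b, P a b * ‖v b‖ := Finset.sum_congr rfl fun b _ => by
            simp [hA, abs_of_nonneg (h0 a b)]
        _ ≤ ∑ b, P a b * (c * h b) :=
            Finset.sum_le_sum fun b _ => mul_le_mul_of_nonneg_left (hvc b) (h0 a b)
        _ = c * (P *ᵥ h) a := by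
            simp only [Matrix.mulVec, dotProduct, Finset.mul_sum]
            exact Finset.sum_congr rfl fun b _ => by ring
        _ = _ := by rw [hP]; simp
    rw [hva] at key
    have : 0 < c * h a := mul_pos hc (hh a)
    exact le_of_mul_le_mul_right (by linarith) this
  have hsr : spectralRadius ℂ A = ENNReal.ofReal Λ := by
    apply le_antisymm
    · refine iSup₂_le fun z hz => ?_
      change ‖z‖ₑ ≤ _
      rw [← ofReal_norm]
      exact ENNReal.ofReal_le_ofReal (hle z hz)
    · have := le_iSup₂ (f := fun (k : ℂ) (_ : k ∈ spectrum ℂ A) => (‖k‖₊ : ℝ≥0∞)) (Λ : ℂ) hΛmem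
      refine le_trans (le_of_eq ?_) this
      change _ = ‖(Λ : ℂ)‖ₑ
      rw [← ofReal_norm, Complex.norm_real, Real.norm_of_nonneg hΛ]
  rw [hsr, ENNReal.toReal_ofReal hΛ]

/-! ### Exponential tilting against words with too many ones. -/

/-- The weight of the words with at least as many ones as zeros is at most a trace of a power of the
tilted matrix. -/
lemma sum_trace_wordProd_le {S : Type*} [Fintype S] [DecidableEq S]
    {M : Fin 2 → Matrix S S ℝ} (hM : ∀ z a b, 0 ≤ M z a b) {θ : ℝ} (hθ : 1 ≤ θ) (N : ℕ) :
    ∑ x : Fin N → Fin 2, (if 2 * (List.ofFn x).count 1 < N then 0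
      else (wordProd M (List.ofFn x)).trace) ≤ ((θ⁻¹ • M 0 + θ • M 1) ^ N).trace := by
  have hθ0 : 0 < θ := by linarith
  let M' : Fin 2 → Matrix S S ℝ := fun z => (if z = 1 then θ else θ⁻¹) • M z
  have hM' : ∑ z, M' z = θ⁻¹ • M 0 + θ • M 1 := by simp [M']
  -- The tilted product carries the factor `θ ^ (#1 - #0)`; multiplying by `θ ^ length` avoids
  -- negative exponents.
  have hword : ∀ l : List (Fin 2), θ ^ l.length • wordProd M' l =
      θ ^ (2 * l.count 1) • wordProd M l := by
    intro l
    induction l with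
    | nil => simp
    | cons z l ih =>
      rw [wordProd_cons, wordProd_cons, List.length_cons, pow_succ', mul_smul,
        ← Matrix.mul_smul, ih]
      fin_cases z
      · simp only [M', Fin.zero_eta, zero_ne_one, if_false, Matrix.smul_mul, Matrix.mul_smul, smul_smul]
        rw [List.count_cons_of_ne zero_ne_one]
        congr 1
        field_simp
      · simp only [M', Fin.mk_one, Matrix.mul_smul, Matrix.smul_mul, if_true, List.count_cons_self,
          smul_smul]
        congr 1
        ring
  rw [← hM', ← sum_wordProd, Matrix.trace_sum]
  refine Finset.sum_le_sum fun x _ => ?_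
  have htr : ∀ l, 0 ≤ (wordProd M l).trace := fun l =>
    Finset.sum_nonneg fun a _ => wordProd_nonneg hM l a a
  have hx := congrArg Matrix.trace (hword (List.ofFn x))
  simp only [Matrix.trace_smul, smul_eq_mul, List.length_ofFn] at hx
  have hN : 0 < θ ^ N := pow_pos hθ0 N
  split_ifs with hc
  · refine nonneg_of_mul_nonneg_right (a := θ ^ N) ?_ hN
    rw [hx]
    exact mul_nonneg (pow_nonneg hθ0.le _) (htr _)
  · refine le_of_mul_le_mul_left ?_ hN
    rw [hx]
    exact mul_le_mul_of_nonneg_right (pow_le_pow_right₀ hθ (not_lt.1 hc)) (htr _)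

/-! ### Cylinder sets and weak convergence -/

/-- The configurations that read `l` at the sites `m, m + 1, …`. -/
def cyl {T : Type*} (m : ℤ) (l : List T) : Set (ℤ → T) :=
  {ω | ∀ (i : ℕ) (h : i < l.length), ω (m + i) = l[i]}

lemma cyl_eq_biInter {T : Type*} (m : ℤ) (l : List T) :
    cyl m l = ⋂ i : Fin l.length, (fun ω : ℤ → T => ω (m + (i : ℕ))) ⁻¹' {l[i]} := by
  ext ω
  simp only [cyl, Set.mem_ofPred_eq, Set.mem_iInter, Set.mem_preimage, Set.mem_singleton_iff]
  exact ⟨fun h i => h i i.2, fun h i hi => h ⟨i, hi⟩⟩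

lemma isClopen_cyl {T : Type*} [TopologicalSpace T] [DiscreteTopology T] (m : ℤ) (l : List T) :
    IsClopen (cyl m l) := by
  rw [cyl_eq_biInter]
  exact isClopen_iInter_of_finite fun i => (isClopen_discrete _).preimage (continuous_apply _)

lemma measurableSet_cyl {T : Type*} [MeasurableSpace T] [MeasurableSingletonClass T] (m : ℤ)
    (l : List T) : MeasurableSet (cyl m l) := by
  rw [cyl_eq_biInter]
  exact MeasurableSet.iInter fun i => measurable_pi_apply _ (measurableSet_singleton _)

lemma cyl_append_singleton {T : Type*} (m : ℤ) (l : List T) (t : T) :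
    cyl m (l ++ [t]) = {ω | ω ∈ cyl m l ∧ ω (m + l.length) = t} := by
  ext ω
  simp only [cyl, Set.mem_ofPred_eq, List.length_append, List.length_singleton]
  constructor
  · intro h
    refine ⟨fun i hi => ?_, ?_⟩
    · rw [h i (by omega), List.getElem_append_left hi]
    · rw [h l.length (by omega), List.getElem_append_right le_rfl]; simp
  · rintro ⟨h1, h2⟩ i hi
    rcases Nat.lt_or_ge i l.length with h | h
    · rw [List.getElem_append_left h, h1 i h]
    · obtain rfl : i = l.length := by omega
      rw [h2, List.getElem_append_right le_rfl]; simp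

/-- The configurations that agree with `a` on `{-k, …, k}`. -/
def symmCyl {T : Type*} (k : ℕ) (a : ℤ → T) : Set (ℤ → T) :=
  cyl (-k) (List.ofFn fun i : Fin (2 * k + 1) => a (-k + (i : ℕ)))

lemma mem_symmCyl {T : Type*} {k : ℕ} {a ω : ℤ → T} :
    ω ∈ symmCyl k a ↔ ∀ j : ℤ, -k ≤ j → j ≤ k → ω j = a j := by
  simp only [symmCyl, cyl, Set.mem_ofPred_eq, List.length_ofFn, List.getElem_ofFn]
  constructor
  · intro h j h1 h2
    have := h (j + k).toNat (by omega)
    rwa [show (-(k : ℤ) + ((j + k).toNat : ℤ)) = j by omega] at this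
  · intro h i hi
    exact h _ (by omega) (by omega)

/-- Symmetric cylinders are closed under nonempty intersection, since the wider window wins, and
they form neighbourhood bases. A π-system of this kind determines weak convergence. -/
theorem tendsto_of_tendsto_cyl {T ι : Type*} [Finite T] [TopologicalSpace T] [DiscreteTopology T]
    [MeasurableSpace T] [BorelSpace T] {μ : ι → ProbabilityMeasure (ℤ → T)}
    {ν : ProbabilityMeasure (ℤ → T)} {F : Filter ι} [F.IsCountablyGenerated]
    (h : ∀ m l, Tendsto (fun i => (μ i : Measure (ℤ → T)).real (cyl m l)) F
      (𝓝 ((ν : Measure (ℤ → T)).real (cyl m l)))) : Tendsto μ F (𝓝 ν) := by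
  have hpi : IsPiSystem {C : Set (ℤ → T) | ∃ k a, C = symmCyl k a} := by
    rintro _ ⟨k, a, rfl⟩ _ ⟨k', a', rfl⟩ ⟨ω, h1, h2⟩
    refine ⟨max k k', ω, ?_⟩
    ext ω'
    simp only [Set.mem_inter_iff, mem_symmCyl] at h1 h2 ⊢
    constructor
    · rintro ⟨h3, h4⟩ j hj hj'
      by_cases hk : -(k : ℤ) ≤ j ∧ j ≤ k
      · rw [h3 j hk.1 hk.2, h1 j hk.1 hk.2]
      · rw [h4 j (by omega) (by omega), h2 j (by omega) (by omega)]
    · intro h3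
      exact ⟨fun j hj hj' => (h3 j (by omega) (by omega)).trans (h1 j hj hj'),
        fun j hj hj' => (h3 j (by omega) (by omega)).trans (h2 j hj hj')⟩
  refine hpi.tendsto_probabilityMeasure_of_tendsto_of_mem ?_ ?_ ?_
  · rintro _ ⟨k, a, rfl⟩
    exact measurableSet_cyl _ _
  · intro u hu x hx
    obtain ⟨I, v, hv, hsub⟩ := isOpen_pi_iff.1 hu x hx
    refine ⟨_, ⟨I.sup Int.natAbs, x, rfl⟩, ?_, fun ω hω => hsub fun j hj => ?_⟩
    · exact (isClopen_cyl _ _).isOpen.mem_nhds (mem_symmCyl.2 fun _ _ _ => rfl)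
    · have hle : Int.natAbs j ≤ I.sup Int.natAbs := Finset.le_sup (f := Int.natAbs) hj
      rw [mem_symmCyl.1 hω j (by omega) (by omega)]
      exact (hv j hj).2
  · rintro _ ⟨k, a, rfl⟩
    exact NNReal.tendsto_coe.1 (h _ _)

lemma eq_of_cyl_eq {T : Type*} [Finite T] [TopologicalSpace T] [DiscreteTopology T]
    [MeasurableSpace T] [BorelSpace T] {μ ν : ProbabilityMeasure (ℤ → T)}
    (h : ∀ m l, (μ : Measure (ℤ → T)).real (cyl m l) = (ν : Measure (ℤ → T)).real (cyl m l)) :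
    μ = ν :=
  tendsto_nhds_unique (f := fun _ : ℕ => μ) (l := atTop) tendsto_const_nhds
    (tendsto_of_tendsto_cyl fun m l => by rw [h m l]; exact tendsto_const_nhds)

/-! ### Periodic laws with matrix product weights -/

/-- Cyclic repetition of `x`, with `x 0` at site `1`. -/
def periodize {T : Type*} (N : ℕ+) (x : Fin N → T) : ℤ → T := fun n =>
  x ⟨((n - 1) % ((N : ℕ) : ℤ)).toNat, by
    have hN : (0 : ℤ) < ((N : ℕ) : ℤ) := by exact_mod_cast N.pos
    have h1 := Int.emod_nonneg (n - 1) hN.ne'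
    have h2 := Int.emod_lt_of_pos (n - 1) hN
    omega⟩

/-- Site `m` carries the letter of index `m - 1` modulo `N`, so reading from `m` is reading the word
rotated by that index. -/
lemma periodize_mem_cyl {T : Type*} (N : ℕ+) (x : Fin N → T) (m : ℤ) {l : List T}
    (hl : l.length ≤ N) :
    periodize N x ∈ cyl m l ↔
      l <+: (List.ofFn x).rotate ((m - 1) % ((N : ℕ) : ℤ)).toNat := by
  have hN : (0 : ℤ) < ((N : ℕ) : ℤ) := by exact_mod_cast N.pos
  have h1 := Int.emod_nonneg (m - 1) hN.ne'
  rw [List.prefix_iff_getElem]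
  simp only [cyl, Set.mem_ofPred_eq, List.length_rotate, List.length_ofFn, List.getElem_rotate,
    List.getElem_ofFn, periodize]
  have key : ∀ i : ℕ, ((m + i - 1) % ((N : ℕ) : ℤ)).toNat =
      (i + ((m - 1) % ((N : ℕ) : ℤ)).toNat) % N := by
    intro i
    zify
    rw [Int.toNat_of_nonneg (Int.emod_nonneg _ hN.ne'), Int.toNat_of_nonneg h1, Int.add_emod_emod]
    congr 1
    ring
  constructor
  · intro h
    refine ⟨hl, fun i hi => ?_⟩
    rw [← h i hi]
    congr 2
    exact key i
  · rintro ⟨_, h⟩ i hi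
    rw [h i hi]
    congr 2
    exact key i

/-- Rotation of words of length `N`. -/
def rotateEquiv (T : Type*) (N : ℕ+) (k : ℕ) : (Fin N → T) ≃ (Fin N → T) :=
  (Equiv.addRight (Fin.ofNat N k)).symm.arrowCongr (Equiv.refl T)

lemma ofFn_rotateEquiv {T : Type*} (N : ℕ+) (k : ℕ) (x : Fin N → T) :
    List.ofFn (rotateEquiv T N k x) = (List.ofFn x).rotate k := by
  refine List.ext_getElem (by simp) fun i h1 h2 => ?_
  simp only [List.getElem_ofFn, List.getElem_rotate, List.length_ofFn, rotateEquiv,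
    Equiv.arrowCongr_apply, Equiv.symm_symm, Function.comp, Equiv.coe_refl, id,
    Equiv.coe_addRight]
  congr 1
  ext
  simp [Fin.val_add]

section periodic
variable {S T : Type*} [Fintype S] [DecidableEq S] [Fintype T] [DecidableEq T]
  {M : T → Matrix S S ℝ} {π : S → ℝ}

/-- The trace weights of the periodic words that start with `l` converge. -/
lemma tendsto_sum_trace_of_prefix
    (hM : ∀ z a b, 0 ≤ M z a b)
    (hπ : ∀ a b, Tendsto (fun n => ((∑ z, M z) ^ n) a b) atTop (𝓝 (π b)))
    (good : List T → Prop) [DecidablePred good]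
    (hbad : Tendsto (fun N : ℕ+ => ∑ x : Fin N → T,
      if good (List.ofFn x) then 0 else (wordProd M (List.ofFn x)).trace) atTop (𝓝 0))
    (l : List T) :
    Tendsto (fun N : ℕ+ => ∑ x : Fin N → T, if l <+: List.ofFn x then
      (if good (List.ofFn x) then (wordProd M (List.ofFn x)).trace else 0) else 0) atTop
      (𝓝 (∑ b, (π ᵥ* wordProd M l) b)) := by
  have hN : Tendsto (fun N : ℕ+ => (N : ℕ)) atTop atTop := by
    refine tendsto_atTop.2 fun b => ?_
    filter_upwards [eventually_ge_atTop b.succPNat] with N h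
    exact (Nat.le_succ b).trans h
  have hF : Tendsto (fun N : ℕ+ => (wordProd M l * (∑ z, M z) ^ ((N : ℕ) - l.length)).trace) atTop
      (𝓝 (∑ b, (π ᵥ* wordProd M l) b)) := by
    have : ∑ b, (π ᵥ* wordProd M l) b = ∑ a, ∑ b, wordProd M l a b * π a := by
      simp only [Matrix.vecMul, dotProduct]
      rw [Finset.sum_comm]
      simp only [mul_comm]
    rw [this]
    simp only [Matrix.trace, Matrix.diag, Matrix.mul_apply]
    refine tendsto_finsetSum _ fun a _ => tendsto_finsetSum _ fun b _ => Tendsto.const_mul _ ?_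
    exact (hπ b a).comp ((tendsto_sub_atTop_nat _).comp hN)
  have htr : ∀ l, 0 ≤ (wordProd M l).trace := fun l =>
    Finset.sum_nonneg fun a _ => wordProd_nonneg hM l a a
  have hL := hF.sub hbad
  rw [sub_zero] at hL
  have hfull : ∀ N : ℕ+, l.length ≤ N → (wordProd M l * (∑ z, M z) ^ ((N : ℕ) - l.length)).trace =
      ∑ x : Fin N → T, if l <+: List.ofFn x then (wordProd M (List.ofFn x)).trace else 0 := by
    intro N h
    rw [← sum_wordProd_of_prefix M l N h, Matrix.trace_sum]
    refine Finset.sum_congr rfl fun x _ => ?_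
    split_ifs <;> simp
  have hev : ∀ᶠ N : ℕ+ in atTop, l.length ≤ N := hN.eventually_ge_atTop _
  -- Removing the bad words lowers the full prefix sum by at most the total bad weight, which tends
  -- to zero.
  refine tendsto_of_tendsto_of_tendsto_of_le_of_le' hL hF ?_ ?_
  · filter_upwards [hev] with N h
    rw [hfull N h, ← Finset.sum_sub_distrib]
    refine Finset.sum_le_sum fun x _ => ?_
    have := htr (List.ofFn x)
    split_ifs <;> simp [this]
  · filter_upwards [hev] with N h
    rw [hfull N h]
    refine Finset.sum_le_sum fun x _ => ?_
    have := htr (List.ofFn x)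
    split_ifs <;> simp [this]

/-- Cylinder probabilities of periodic configurations whose weights are traces of matrix products,
restricted to good words. -/
theorem tendsto_periodize_cyl [Nonempty S] [MeasurableSpace T] [MeasurableSingletonClass T]
    (hM : ∀ z a b, 0 ≤ M z a b) (h1 : ∀ a, ∑ b, (∑ z, M z) a b = 1)
    (hπ : ∀ a b, Tendsto (fun n => ((∑ z, M z) ^ n) a b) atTop (𝓝 (π b)))
    (good : List T → Prop) [DecidablePred good] (hgood : ∀ l k, good (l.rotate k) ↔ good l)
    (hbad : Tendsto (fun N : ℕ+ => ∑ x : Fin N → T,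
      if good (List.ofFn x) then 0 else (wordProd M (List.ofFn x)).trace) atTop (𝓝 0))
    (q : ∀ N : ℕ+, PMF (Fin N → T))
    (hq : ∀ᶠ N in atTop, ∃ Z : ℝ, ∀ x, (q N x).toReal =
      Z * if good (List.ofFn x) then (wordProd M (List.ofFn x)).trace else 0)
    (m : ℤ) (l : List T) :
    Tendsto (fun N : ℕ+ => ((q N).map (periodize N)).toMeasure.real (cyl m l)) atTop
      (𝓝 (∑ b, (π ᵥ* wordProd M l) b)) := by
  have hE := tendsto_sum_trace_of_prefix hM hπ good hbad
  have hnil : ∑ b, (π ᵥ* wordProd M []) b = 1 := by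
    simpa using (limit_of_stochastic h1 hπ).1
  -- The empty prefix gives the partition function, whose limit is one.
  have hdiv := (hE l).div (hE []) (by rw [hnil]; exact one_ne_zero)
  rw [hnil, div_one] at hdiv
  refine hdiv.congr' ?_
  filter_upwards [hq, eventually_ge_atTop l.length.succPNat] with N ⟨Z, hZ⟩ hN
  have hlN : l.length ≤ N := (Nat.le_succ _).trans hN
  have hone : ∑ x, (q N x).toReal = 1 := by
    rw [← ENNReal.toReal_sum fun x _ => (q N).apply_ne_top x, ← tsum_fintype (L := .unconditional _),
      (q N).tsum_coe, ENNReal.toReal_one]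
  simp only [hZ, ← Finset.mul_sum] at hone
  have hmeas : ((q N).map (periodize N)).toMeasure.real (cyl m l) =
      ∑ x : Fin N → T, if l <+: (List.ofFn x).rotate ((m - 1) % ((N : ℕ) : ℤ)).toNat then
        (q N x).toReal else 0 := by
    rw [measureReal_def, PMF.toMeasure_apply_eq_toOuterMeasure_apply _ (measurableSet_cyl m l),
      PMF.toOuterMeasure_map_apply, PMF.toOuterMeasure_apply_fintype, ENNReal.toReal_sum]
    · refine Finset.sum_congr rfl fun x _ => ?_
      classical
      rw [Set.indicator_apply]
      simp only [Set.mem_preimage, periodize_mem_cyl N _ m hlN]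
      split_ifs <;> simp
    · intro x _
      classical
      rw [Set.indicator_apply]
      split_ifs
      · exact (q N).apply_ne_top x
      · simp
  rw [hmeas]
  simp only [hZ, ← ofFn_rotateEquiv]
  set k := ((m - 1) % ((N : ℕ) : ℤ)).toNat
  have hrot : ∀ x : Fin N → T, (if good (List.ofFn x) then (wordProd M (List.ofFn x)).trace else 0) =
      if good (List.ofFn (rotateEquiv T N k x)) then
        (wordProd M (List.ofFn (rotateEquiv T N k x))).trace else 0 := by
    intro x
    simp only [ofFn_rotateEquiv, hgood, trace_wordProd_rotate]
  have hR : ∑ x : Fin N → T, (if l <+: List.ofFn (rotateEquiv T N k x) then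
      Z * (if good (List.ofFn x) then (wordProd M (List.ofFn x)).trace else 0) else 0) =
      Z * ∑ x : Fin N → T, if l <+: List.ofFn x then
        (if good (List.ofFn x) then (wordProd M (List.ofFn x)).trace else 0) else 0 := by
    rw [← (rotateEquiv T N k).sum_comp (fun x => if l <+: List.ofFn x then
      (if good (List.ofFn x) then (wordProd M (List.ofFn x)).trace else 0) else 0), Finset.mul_sum]
    refine Finset.sum_congr rfl fun x _ => ?_
    rw [hrot x]
    exact (mul_ite_zero _ _ _).symm
  rw [hR]
  simp only [Pi.div_apply, List.nil_prefix, if_true]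
  rw [div_eq_iff (right_ne_zero_of_mul_eq_one hone), mul_right_comm, hone, one_mul]

/-- There is a law on `ℤ → T` with given matrix product cylinder probabilities. -/
theorem exists_law_cyl [TopologicalSpace T] [DiscreteTopology T] [MeasurableSpace T] [BorelSpace T]
    [Nonempty S] [Nonempty T]
    (hM : ∀ z a b, 0 ≤ M z a b) (h1 : ∀ a, ∑ b, (∑ z, M z) a b = 1)
    (hπ : ∀ a b, Tendsto (fun n => ((∑ z, M z) ^ n) a b) atTop (𝓝 (π b))) :
    ∃ ν : ProbabilityMeasure (ℤ → T), ∀ m l,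
      (ν : Measure (ℤ → T)).real (cyl m l) = ∑ b, (π ᵥ* wordProd M l) b := by
  have htr : ∀ l, 0 ≤ (wordProd M l).trace := fun l =>
    Finset.sum_nonneg fun a _ => wordProd_nonneg hM l a a
  have hexq : ∀ N : ℕ+, ∃ q : PMF (Fin N → T),
      0 < ∑ x : Fin N → T, (wordProd M (List.ofFn x)).trace →
      ∃ Z : ℝ, ∀ x, (q x).toReal = Z * (wordProd M (List.ofFn x)).trace := by
    intro N
    by_cases h : 0 < ∑ x : Fin N → T, (wordProd M (List.ofFn x)).trace
    · refine ⟨PMF.normalize (fun x => ENNReal.ofReal (wordProd M (List.ofFn x)).trace) ?_ ?_,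
        fun _ => ⟨(ENNReal.toReal (∑ x : Fin N → T,
          ENNReal.ofReal (wordProd M (List.ofFn x)).trace)⁻¹), fun x => ?_⟩⟩
      · rw [tsum_fintype, ← ENNReal.ofReal_sum_of_nonneg fun x _ => htr _]
        simpa using h
      · rw [tsum_fintype]
        exact ENNReal.sum_ne_top.2 fun x _ => ENNReal.ofReal_ne_top
      · rw [PMF.normalize_apply, ENNReal.toReal_mul, tsum_fintype, ENNReal.toReal_ofReal (htr _),
          mul_comm]
    · exact ⟨PMF.pure (Classical.arbitrary _), fun h' => absurd h' h⟩
  choose q hq using hexq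
  have hbad : Tendsto (fun N : ℕ+ => ∑ x : Fin N → T,
      if True then 0 else (wordProd M (List.ofFn x)).trace) atTop (𝓝 0) := by simp
  have hpos : ∀ᶠ N : ℕ+ in atTop, 0 < ∑ x : Fin N → T, (wordProd M (List.ofFn x)).trace := by
    have := tendsto_sum_trace_of_prefix hM hπ (fun _ => True) hbad []
    simp only [List.nil_prefix, if_true, wordProd_nil, Matrix.vecMul_one,
      (limit_of_stochastic h1 hπ).1] at this
    exact this.eventually_const_lt one_pos
  have hlim := tendsto_periodize_cyl hM h1 hπ (fun _ => True) (by simp) hbad q (by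
    filter_upwards [hpos] with N hN
    simpa using hq N hN)
  let μ : ℕ+ → ProbabilityMeasure (ℤ → T) := fun N =>
    ⟨((q N).map (periodize N)).toMeasure, inferInstance⟩
  -- Probability measures on the compact space `ℤ → T` form a compact space. Cylinders are clopen,
  -- so their probabilities pass to the limit along the ultrafilter.
  let U : Ultrafilter ℕ+ := Ultrafilter.of atTop
  obtain ⟨ν, -, hν⟩ := isCompact_univ.ultrafilter_le_nhds (U.map μ) (by simp)
  refine ⟨ν, fun m l => ?_⟩
  have hν' : Tendsto μ U (𝓝 ν) := hν
  have h2 : Tendsto (fun N => μ N (cyl m l)) U (𝓝 (ν (cyl m l))) :=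
    ProbabilityMeasure.tendsto_measure_of_null_frontier_of_tendsto hν' (by
      simp [(isClopen_cyl m l).frontier_eq])
  exact tendsto_nhds_unique (NNReal.tendsto_coe.2 h2) ((hlim m l).mono_left (Ultrafilter.of_le _))

end periodic

/-! ### Stationary Markov laws -/

/-- The transitions of `P` with output `z`. -/
def outputMatrix {S T : Type*} [DecidableEq T] (P : Matrix S S ℝ) (out : S → S → T) (z : T) :
    Matrix S S ℝ := fun a b => if out a b = z then P a b else 0

lemma sum_outputMatrix {S T : Type*} [Fintype T] [DecidableEq T] (P : Matrix S S ℝ)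
    (out : S → S → T) : ∑ z, outputMatrix P out z = P := by
  ext a b
  simp [Matrix.sum_apply, outputMatrix]

lemma outputMatrix_nonneg {S T : Type*} [DecidableEq T] {P : Matrix S S ℝ}
    (h0 : ∀ a b, 0 ≤ P a b) (out : S → S → T) (z : T) (a b : S) : 0 ≤ outputMatrix P out z a b := by
  unfold outputMatrix
  split_ifs
  · exact h0 a b
  · exact le_rfl

/-- The sequence of outputs along a path. -/
def outputPath {S T : Type*} (out : S → S → T) (ω : ℤ → S) : ℤ → T := fun n => out (ω (n - 1)) (ω n)

lemma measurable_outputPath {S T : Type*} [Finite S] [MeasurableSpace S] [MeasurableSingletonClass S]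
    [MeasurableSpace T] (out : S → S → T) : Measurable (outputPath out) := by
  refine measurable_pi_lambda _ fun n => ?_
  have h : Measurable fun p : S × S => out p.1 p.2 := measurable_of_finite _
  have h' : Measurable fun ω : ℤ → S => (ω (n - 1), ω n) :=
    (measurable_pi_apply (n - 1)).prodMk (measurable_pi_apply n)
  exact h.comp h'

lemma measurableSet_eval_eq {S : Type*} [MeasurableSpace S] [MeasurableSingletonClass S] (n : ℤ)
    (a : S) : MeasurableSet {ω : ℤ → S | ω n = a} :=
  (measurable_pi_apply (X := fun _ : ℤ => S) n) (measurableSet_singleton a)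

section
variable {S : Type} [Fintype S] [MeasurableSpace S] [MeasurableSingletonClass S]
  {P : Matrix S S ℝ} {ν : ProbabilityMeasure (ℤ → S)}

lemma IsStationaryMarkovLaw.marginal (h : IsStationaryMarkovLaw P ν) (n : ℤ) (a : S) :
    (ν : Measure (ℤ → S)).real {ω | ω n = a} = (ν : Measure (ℤ → S)).real {ω | ω 0 = a} := by
  have step : ∀ k : ℤ, (ν : Measure (ℤ → S)).real {ω | ω (k + 1) = a} =
      (ν : Measure (ℤ → S)).real {ω | ω k = a} := fun k => by
    have := h.stationary.measure_preimage (s := {ω | ω k = a})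
      (measurableSet_eval_eq k a).nullMeasurableSet
    rw [measureReal_def, measureReal_def, ← this]
    rfl
  induction n using Int.induction_on with
  | zero => rfl
  | succ n ih => rw [step, ih]
  | pred n ih => rw [← step, sub_add_cancel, ih]

/-- The Markov property, given an event in the past. -/
lemma IsStationaryMarkovLaw.markov_past (h : IsStationaryMarkovLaw P ν) (m : ℤ) (n : ℕ)
    (A : Set (Fin (n + 1) → S)) (a b : S) :
    (ν : Measure (ℤ → S)).real
      {ω | ((fun i : Fin (n + 1) => ω (m + (i : ℕ))) ∈ A ∧ ω (m + n) = a) ∧ ω (m + n + 1) = b} =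
    (ν : Measure (ℤ → S)).real
      {ω | (fun i : Fin (n + 1) => ω (m + (i : ℕ))) ∈ A ∧ ω (m + n) = a} * P a b := by
  classical
  set f : (ℤ → S) → Fin (n + 1) → S := fun ω i => ω (m + (i : ℕ)) with hf
  let F : Finset (Fin (n + 1) → S) := Finset.univ.filter fun s => s ∈ A ∧ s (Fin.last n) = a
  have hfm : Measurable f := measurable_pi_lambda _ fun i => measurable_pi_apply _
  have hfs : ∀ s, MeasurableSet (f ⁻¹' {s}) := fun s => hfm (measurableSet_singleton s)
  have e1 : {ω | f ω ∈ A ∧ ω (m + n) = a} = ⋃ s ∈ F, f ⁻¹' {s} := by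
    ext ω
    simp [F, hf]
  have e2 : {ω | (f ω ∈ A ∧ ω (m + n) = a) ∧ ω (m + n + 1) = b} =
      ⋃ s ∈ F, (f ⁻¹' {s} ∩ {ω | ω (m + n + 1) = b}) := by
    ext ω
    simp [F, hf]
  have hdisj : Set.PairwiseDisjoint (F : Set (Fin (n + 1) → S)) fun s => f ⁻¹' {s} :=
    fun s _ t _ hst => Disjoint.preimage f (by simpa using hst)
  rw [e1, e2, measureReal_biUnion_finset hdisj fun s _ => hfs s,
    measureReal_biUnion_finset (hdisj.mono fun s => Set.inter_subset_left) fun s _ =>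
      (hfs s).inter (measurableSet_eval_eq _ _), Finset.sum_mul]
  refine Finset.sum_congr rfl fun s hs => ?_
  have hsa : s (Fin.last n) = a := (Finset.mem_filter.1 hs).2.2
  let s' : ℕ → S := fun i => if hi : i < n + 1 then s ⟨i, hi⟩ else a
  have hs' : f ⁻¹' {s} = {ω | ∀ i ≤ n, ω (m + i) = s' i} := by
    ext ω
    simp only [Set.mem_preimage, Set.mem_singleton_iff, Set.mem_ofPred_eq, funext_iff, hf]
    constructor
    · intro H i hi
      simpa [s', hi] using H ⟨i, Nat.lt_succ_of_le hi⟩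
    · intro H i
      simpa [s', Nat.le_of_lt_succ i.2] using H i (Nat.le_of_lt_succ i.2)
  have hn : s' n = a := by
    rw [← hsa]
    simp only [s', Nat.lt_succ_self, dif_pos]
    rfl
  rw [hs', ← hn, ← h.markov m n s' b]
  rfl

lemma sum_measureReal_inter_eval (B : Set (ℤ → S)) (hB : MeasurableSet B) (n : ℤ) :
    ∑ a, (ν : Measure (ℤ → S)).real (B ∩ {ω | ω n = a}) = (ν : Measure (ℤ → S)).real B := by
  have : B = ⋃ a ∈ (Finset.univ : Finset S), (B ∩ {ω | ω n = a}) := by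
    ext ω
    simp
  conv_rhs => rw [this]
  rw [measureReal_biUnion_finset]
  · intro a _ b _ hab
    rw [Function.onFun, Set.disjoint_left]
    rintro ω ⟨-, h1⟩ ⟨-, h2⟩
    exact hab (h1.symm.trans h2)
  · exact fun a _ => hB.inter (measurableSet_eval_eq n a)

variable [DecidableEq S] [Nonempty S]

/-- Shift invariance and the Markov property make the one-site law invariant under `P`, and `π` is
the only invariant probability vector. -/
lemma IsStationaryMarkovLaw.marginal_eq (h : IsStationaryMarkovLaw P ν)
    (h1 : ∀ a, ∑ b, P a b = 1) {π : S → ℝ}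
    (hπ : ∀ a b, Tendsto (fun n => (P ^ n) a b) atTop (𝓝 (π b))) (n : ℤ) (a : S) :
    (ν : Measure (ℤ → S)).real {ω | ω n = a} = π a := by
  set ρ : S → ℝ := fun a => (ν : Measure (ℤ → S)).real {ω | ω 0 = a} with hρ
  have hρ1 : ∑ b, ρ b = 1 := by
    have := sum_measureReal_inter_eval (ν := ν) Set.univ MeasurableSet.univ 0
    simpa [hρ] using this
  have hρP : ρ ᵥ* P = ρ := by
    ext b
    have e := sum_measureReal_inter_eval (ν := ν) {ω | ω 1 = b} (measurableSet_eval_eq 1 b) 0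
    have hm : ∀ a, (ν : Measure (ℤ → S)).real ({ω | ω 1 = b} ∩ {ω | ω 0 = a}) = ρ a * P a b := by
      intro a
      have := h.markov 0 0 (fun _ => a) b
      simp only [Nat.le_zero, forall_eq, Nat.cast_zero, add_zero, zero_add] at this
      rw [Set.inter_comm]
      exact this
    simp only [hm] at e
    rw [Matrix.vecMul, dotProduct, e]
    exact h.marginal 1 b
  rw [h.marginal n a]
  exact congrFun ((limit_of_stochastic h1 hπ).2.2 ρ hρ1 hρP) a

variable {T : Type*} [DecidableEq T] [MeasurableSpace T] [MeasurableSingletonClass T]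

/-- Cylinder probabilities of the outputs of a stationary Markov chain. -/
theorem IsStationaryMarkovLaw.map_outputPath_cyl (h : IsStationaryMarkovLaw P ν)
    (h1 : ∀ a, ∑ b, P a b = 1) {π : S → ℝ}
    (hπ : ∀ a b, Tendsto (fun n => (P ^ n) a b) atTop (𝓝 (π b))) (out : S → S → T)
    (m : ℤ) (l : List T) :
    ((ν : Measure (ℤ → S)).map (outputPath out)).real (cyl m l) =
      ∑ b, (π ᵥ* wordProd (outputMatrix P out) l) b := by
  have hmeas := measurable_outputPath (S := S) out
  -- Tracking the current state closes the induction on the right end of the word. The chain starts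
  -- at `m - 1` because the output at `m` belongs to the transition from `m - 1` to `m`.
  have key : ∀ l : List T, ∀ b, (ν : Measure (ℤ → S)).real
      (outputPath out ⁻¹' cyl m l ∩ {ω | ω (m - 1 + l.length) = b}) =
      (π ᵥ* wordProd (outputMatrix P out) l) b := by
    intro l
    induction l using List.reverseRecOn with
    | nil =>
      intro b
      have : (cyl m ([] : List T)) = Set.univ := by ext; simp [cyl]
      simp [this, h.marginal_eq h1 hπ]
    | append_singleton l z ih =>
      intro b
      have hpast : ∃ A : Set (Fin (l.length + 1) → S), outputPath out ⁻¹' cyl m l =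
          {ω | (fun i : Fin (l.length + 1) => ω (m - 1 + (i : ℕ))) ∈ A} := by
        refine ⟨{s | ∀ (i : ℕ) (hi : i < l.length),
          out (s ⟨i, by omega⟩) (s ⟨i + 1, by omega⟩) = l[i]}, ?_⟩
        ext ω
        simp only [cyl, outputPath, Set.mem_preimage, Set.mem_ofPred_eq]
        refine forall_congr' fun i => forall_congr' fun hi => ?_
        rw [show m + (i : ℤ) - 1 = m - 1 + i by ring,
          show m + (i : ℤ) = m - 1 + ((i + 1 : ℕ) : ℤ) by push_cast; ring]
      obtain ⟨A, hA⟩ := hpast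
      have hB : MeasurableSet (outputPath out ⁻¹' cyl m (l ++ [z]) ∩
          {ω | ω (m - 1 + (l ++ [z]).length) = b}) :=
        (hmeas (measurableSet_cyl _ _)).inter (measurableSet_eval_eq _ _)
      rw [← sum_measureReal_inter_eval _ hB (m - 1 + l.length), wordProd_append,
        ← Matrix.vecMul_vecMul]
      simp only [wordProd_cons, wordProd_nil, mul_one]
      rw [Matrix.vecMul, dotProduct]
      refine Finset.sum_congr rfl fun a _ => ?_
      rw [← ih a]
      by_cases hz : out a b = z
      · rw [outputMatrix, if_pos hz, hA]
        refine Eq.trans ?_ (h.markov_past (m - 1) l.length A a b)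
        congr 1
        ext ω
        have hA' : outputPath out ω ∈ cyl m l ↔
            (fun i : Fin (l.length + 1) => ω (m - 1 + (i : ℕ))) ∈ A := by
          exact Set.ext_iff.1 hA ω
        simp only [cyl_append_singleton, Set.mem_inter_iff, Set.mem_preimage, Set.mem_ofPred_eq,
          hA', List.length_append, List.length_singleton]
        rw [show m - 1 + ((l.length + 1 : ℕ) : ℤ) = m - 1 + l.length + 1 by push_cast; ring]
        constructor
        · rintro ⟨⟨⟨h1, -⟩, h2⟩, h3⟩
          exact ⟨⟨h1, h3⟩, h2⟩
        · rintro ⟨⟨h1, h3⟩, h2⟩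
          refine ⟨⟨⟨h1, ?_⟩, h2⟩, h3⟩
          rw [outputPath, show m + (l.length : ℤ) - 1 = m - 1 + l.length by ring,
            show m + (l.length : ℤ) = m - 1 + l.length + 1 by ring, h3, h2, hz]
      · rw [outputMatrix, if_neg hz, mul_zero]
        convert measureReal_empty
        ext ω
        simp only [cyl_append_singleton, Set.mem_inter_iff, Set.mem_preimage, Set.mem_ofPred_eq,
          List.length_append, List.length_singleton, Set.mem_empty_iff_false, iff_false]
        rw [show m - 1 + ((l.length + 1 : ℕ) : ℤ) = m - 1 + l.length + 1 by push_cast; ring]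
        rintro ⟨⟨⟨-, h1⟩, h2⟩, h3⟩
        rw [outputPath, show m + (l.length : ℤ) - 1 = m - 1 + l.length by ring,
          show m + (l.length : ℤ) = m - 1 + l.length + 1 by ring, h3, h2] at h1
        exact hz h1
  rw [map_measureReal_apply hmeas (measurableSet_cyl _ _),
    ← sum_measureReal_inter_eval _ (hmeas (measurableSet_cyl m l)) (m - 1 + l.length)]
  exact Finset.sum_congr rfl fun b _ => key l b

end

lemma cyl_map_range {T : Type*} (m : ℤ) (n : ℕ) (s : ℕ → T) :
    cyl m ((List.range (n + 1)).map s) = {ω | ∀ i ≤ n, ω (m + i) = s i} := by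
  ext ω
  simp [cyl]

/-- A primitive stochastic matrix has a two-sided stationary Markov law. -/
theorem exists_isStationaryMarkovLaw {S : Type} [Fintype S] [DecidableEq S] [Nonempty S]
    [TopologicalSpace S] [DiscreteTopology S] [MeasurableSpace S] [BorelSpace S]
    {P : Matrix S S ℝ} (h0 : ∀ a b, 0 ≤ P a b) (h1 : ∀ a, ∑ b, P a b = 1)
    {π : S → ℝ} (hπ : ∀ a b, Tendsto (fun n => (P ^ n) a b) atTop (𝓝 (π b))) :
    ∃ ν : ProbabilityMeasure (ℤ → S), IsStationaryMarkovLaw P ν := by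
  set M : S → Matrix S S ℝ := outputMatrix P fun _ b => b with hM
  have hsum : ∑ z, M z = P := sum_outputMatrix P _
  obtain ⟨ν, hν⟩ := exists_law_cyl (M := M) (π := π) (outputMatrix_nonneg h0 _)
    (by rw [hsum]; exact h1) (by rw [hsum]; exact hπ)
  have hshift : Measurable fun (ω : ℤ → S) (n : ℤ) => ω (n + 1) :=
    measurable_pi_lambda _ fun n => measurable_pi_apply _
  refine ⟨ν, ⟨hshift, ?_⟩, fun m n s t => ?_⟩
  -- The cylinder formula does not involve the site `m`, hence shift invariance.
  · let ν' : ProbabilityMeasure (ℤ → S) := ν.map hshift.aemeasurable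
    have : ν' = ν := eq_of_cyl_eq fun m l => by
      rw [hν m l, ← hν (m + 1) l]
      change ((ν : Measure (ℤ → S)).map _).real _ = _
      rw [map_measureReal_apply hshift (measurableSet_cyl _ _)]
      congr 1
      ext ω
      simp only [cyl, Set.mem_preimage, Set.mem_ofPred_eq, add_right_comm]
    exact congrArg (fun μ : ProbabilityMeasure (ℤ → S) => (μ : Measure (ℤ → S))) this
  · have e := cyl_append_singleton m ((List.range (n + 1)).map s) t
    rw [cyl_map_range, List.length_map, List.length_range] at e
    have e' : {ω : ℤ → S | (∀ i ≤ n, ω (m + i) = s i) ∧ ω (m + n + 1) = t} =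
        cyl m ((List.range (n + 1)).map s ++ [t]) := by
      rw [e]
      push_cast
      simp only [add_assoc]
      rfl
    rw [e', ← cyl_map_range, hν, hν, wordProd_append, ← Matrix.vecMul_vecMul]
    -- The output is the new state, so after a word ending in `s n` all mass sits at `s n`; the next
    -- factor is then a single entry of `P`.
    have hlast : ∀ c, c ≠ s n → (π ᵥ* wordProd M ((List.range (n + 1)).map s)) c = 0 := by
      intro c hc
      rw [List.range_succ, List.map_append, wordProd_append, ← Matrix.vecMul_vecMul]
      simp only [List.map_cons, List.map_nil, wordProd_cons, wordProd_nil, mul_one]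
      refine Finset.sum_eq_zero fun a _ => ?_
      simp [hM, outputMatrix, hc]
    set u := π ᵥ* wordProd M ((List.range (n + 1)).map s)
    rw [Finset.sum_eq_single (s n) (fun c _ hc => hlast c hc) (by simp)]
    simp only [wordProd_cons, wordProd_nil, mul_one, Matrix.vecMul, dotProduct]
    rw [Finset.sum_eq_single t, Finset.sum_eq_single (s n)]
    · simp [hM, outputMatrix]
    · intro c _ hc
      rw [hlast c hc, zero_mul]
    · simp
    · intro c _ hc
      refine Finset.sum_eq_zero fun a _ => ?_
      simp [hM, outputMatrix, hc]
    · simp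

/-! ### Cylinder probabilities of the product measure. -/

/-- The cylinder probabilities of an i.i.d. configuration. -/
lemma iidLaw_cyl (p : unitInterval) (m : ℤ) (l : List (Fin 2)) :
    (iidLaw p : Measure (ℤ → Fin 2)).real (cyl m l) =
      (l.map fun z => if z = 1 then (p : ℝ) else 1 - p).prod := by
  have hcyl : cyl m l = Set.pi ((Finset.range l.length).map
      ⟨fun i : ℕ => m + (i : ℤ), fun i j h => by simpa using h⟩ : Finset ℤ)
      fun n => {l.getD (n - m).toNat 0} := by
    ext ω
    simp only [cyl, Set.mem_ofPred_eq, Set.mem_pi, Finset.coe_map,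
      Set.mem_image, Finset.coe_range, Set.mem_Iio, Set.mem_singleton_iff, forall_exists_index,
      and_imp, forall_apply_eq_imp_iff₂]
    refine forall_congr' fun i => forall_congr' fun hi => ?_
    change _ ↔ ω (m + i) = l.getD (m + i - m).toNat 0
    rw [add_sub_cancel_left, Int.toNat_natCast, List.getD_eq_getElem _ _ hi]
  rw [hcyl, measureReal_def]
  change ((Measure.infinitePi fun _ : ℤ => bernoulliMeasure (1 : Fin 2) 0 p) _).toReal = _
  rw [Measure.infinitePi_pi _ fun _ _ => measurableSet_singleton _, Finset.prod_map,
    ENNReal.toReal_prod, Finset.prod_range]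
  conv_rhs => rw [← List.ofFn_getElem (xs := l), List.map_ofFn, List.prod_ofFn]
  refine Finset.prod_congr rfl fun i _ => ?_
  change (bernoulliMeasure (1 : Fin 2) 0 p {l.getD (m + (i : ℕ) - m).toNat 0}).toReal = _
  rw [add_sub_cancel_left, Int.toNat_natCast, List.getD_eq_getElem _ _ i.2, ← measureReal_def]
  have key : ∀ z : Fin 2, (bernoulliMeasure (1 : Fin 2) 0 p).real {z} =
      if z = 1 then (p : ℝ) else 1 - p := by
    intro z
    rw [bernoulliMeasure_real_apply p (measurableSet_singleton z)]
    fin_cases z <;> simp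
  exact key _

/-! ### The carrier -/

/-- The load of the carrier after reading one site. -/
def carrierStep (a : ℕ) (z : Fin 2) : ℕ := if z = 1 then a + 1 else a - 1

/-- The final load of the carrier along a word. -/
def carrierEnd : ℕ → List (Fin 2) → ℕ
  | a, [] => a
  | a, z :: l => carrierEnd (carrierStep a z) l

/-- The maximal load of the carrier along a word. -/
def carrierMax : ℕ → List (Fin 2) → ℕ
  | a, [] => a
  | a, z :: l => max a (carrierMax (carrierStep a z) l)

@[simp] lemma carrierStep_zero (a : ℕ) : carrierStep a 0 = a - 1 := by simp [carrierStep]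
@[simp] lemma carrierStep_one (a : ℕ) : carrierStep a 1 = a + 1 := by simp [carrierStep]

lemma le_carrierMax (a : ℕ) (l : List (Fin 2)) : a ≤ carrierMax a l := by
  cases l <;> simp [carrierMax]

lemma carrierEnd_append (a : ℕ) (u v : List (Fin 2)) :
    carrierEnd a (u ++ v) = carrierEnd (carrierEnd a u) v := by
  induction u generalizing a with
  | nil => rfl
  | cons z u ih => simp [carrierEnd, ih]

lemma carrierMax_append (a : ℕ) (u v : List (Fin 2)) :
    carrierMax a (u ++ v) = max (carrierMax a u) (carrierMax (carrierEnd a u) v) := by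
  induction u generalizing a with
  | nil => simp [carrierMax, carrierEnd, le_carrierMax]
  | cons z u ih => simp [carrierEnd, carrierMax, ih, max_assoc]

lemma carrierEnd_mono {a b : ℕ} (h : a ≤ b) (l : List (Fin 2)) :
    carrierEnd a l ≤ carrierEnd b l := by
  induction l generalizing a b with
  | nil => exact h
  | cons z l ih => exact ih (by unfold carrierStep; split_ifs <;> omega)

/-- Either the carrier never tries to unload while empty, or it forgets its initial load. -/
lemma carrierEnd_eq_or (a : ℕ) (l : List (Fin 2)) :
    carrierEnd a l + l.count 0 = a + l.count 1 ∨
      (∃ u v, l = u ++ v ∧ carrierEnd a u = 0) ∧ ∀ b ≤ a, carrierEnd b l = carrierEnd a l := by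
  induction l generalizing a with
  | nil => simp [carrierEnd]
  | cons z l ih =>
    fin_cases z
    · rcases Nat.eq_zero_or_pos a with rfl | ha
      · exact Or.inr ⟨⟨[], _, rfl, rfl⟩, fun b hb => by rw [Nat.le_zero.1 hb]⟩
      · rcases ih (a - 1) with h | ⟨⟨u, v, rfl, hu⟩, h⟩
        · left
          simp only [carrierEnd, Fin.zero_eta, carrierStep_zero, List.count_cons_self,
            List.count_cons_of_ne (show (0 : Fin 2) ≠ 1 by decide)]
          omega
        · right
          refine ⟨⟨0 :: u, v, rfl, by simpa [carrierEnd] using hu⟩, fun b hb => ?_⟩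
          simpa [carrierEnd] using h (b - 1) (by omega)
    · rcases ih (a + 1) with h | ⟨⟨u, v, rfl, hu⟩, h⟩
      · left
        simp only [carrierEnd, Fin.mk_one, carrierStep_one, List.count_cons_self,
          List.count_cons_of_ne (show (1 : Fin 2) ≠ 0 by decide)]
        omega
      · right
        refine ⟨⟨1 :: u, v, rfl, by simpa [carrierEnd] using hu⟩, fun b hb => ?_⟩
        simpa [carrierEnd] using h (b + 1) (by omega)

lemma count_zero_add_count_one (l : List (Fin 2)) : l.count 0 + l.count 1 = l.length := by
  induction l with
  | nil => rfl
  | cons z l ih => fin_cases z <;> simp <;> omega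

/-- If there are more zeros than ones, then the cyclic carrier exists, is unique, and is empty
somewhere. -/
lemma carrierEnd_eq_self_iff {l : List (Fin 2)} (hl : 2 * l.count 1 < l.length) (a : ℕ) :
    carrierEnd a l = a ↔ a = carrierEnd 0 l := by
  have hc := count_zero_add_count_one l
  constructor
  · intro h
    rcases carrierEnd_eq_or a l with h' | ⟨-, h'⟩
    · omega
    · rw [h' 0 a.zero_le, h]
  · rintro rfl
    -- If the carrier never lost an unloading, it would end strictly below its start, against
    -- monotonicity in the initial load. Otherwise it has merged with the path started empty.
    rcases carrierEnd_eq_or (carrierEnd 0 l) l with h' | ⟨-, h'⟩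
    · have := carrierEnd_mono (carrierEnd 0 l).zero_le l
      omega
    · exact (h' 0 (Nat.zero_le _)).symm

/-! ### Contraction of words read linearly -/

/-- Remove all consecutive pairs `(1, 0)`, without cyclic identification. -/
def linearContract : List (Fin 2) → List (Fin 2)
  | [] => []
  | 0 :: l => 0 :: linearContract l
  | [1] => [1]
  | 1 :: 0 :: l => linearContract l
  | 1 :: 1 :: l => 1 :: linearContract (1 :: l)

/-- A removed pair loads one particle and at once unloads it. -/
lemma carrierEnd_linearContract (a : ℕ) (l : List (Fin 2)) :
    carrierEnd a (linearContract l) = carrierEnd a l := by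
  induction l using linearContract.induct generalizing a with
  | case1 => rfl
  | case2 l ih => simp [linearContract, carrierEnd, ih]
  | case3 => rfl
  | case4 l ih => simp [linearContract, carrierEnd, ih]
  | case5 l ih => simp only [linearContract, carrierEnd, ih]

/-- Peaks of the carrier above its initial load are turns from `1` to `0`, and deleting the pair
lowers each by one. A final `1` would be a peak that survives, and an initial load above `k` would
not be lowered; both are excluded. -/
lemma carrierMax_linearContract {k a : ℕ} (ha : a ≤ k) {l : List (Fin 2)}
    (hl : l.getLast? ≠ some 1) :
    carrierMax a (linearContract l) ≤ k ↔ carrierMax a l ≤ k + 1 := by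
  induction l using linearContract.induct generalizing a with
  | case1 => simp [linearContract, carrierMax]; omega
  | case2 l ih =>
    have hl' : l.getLast? ≠ some 1 := by
      intro h
      exact hl (by simp [List.getLast?_cons, h])
    simp only [linearContract, carrierMax, carrierStep_zero, max_le_iff, ih (show a - 1 ≤ k by omega) hl']
    omega
  | case3 => simp at hl
  | case4 l ih =>
    have hl' : l.getLast? ≠ some 1 := by
      intro h
      exact hl (by simp [List.getLast?_cons, h])
    simp only [linearContract, carrierMax, carrierStep_zero, carrierStep_one, max_le_iff,
      add_tsub_cancel_right, ih ha hl']
    omega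
  | case5 l ih =>
    have hl' : (1 :: l).getLast? ≠ some 1 := by
      intro h
      exact hl (by simpa [List.getLast?_cons] using h)
    rcases Nat.lt_or_ge a k with h | h
    · have := ih (show a + 1 ≤ k from h) hl'
      simp only [linearContract]
      rw [carrierMax, carrierMax, carrierStep_one, max_le_iff, max_le_iff, this]
      omega
    -- Both sides fail here: the contracted path still steps up to `k + 1`, and the original reaches
    -- `k + 2`.
    · obtain rfl : a = k := le_antisymm ha h
      simp only [linearContract, carrierMax, carrierStep_one, max_le_iff]
      have h1 := le_carrierMax (a + 1) (linearContract (1 :: l))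
      have h2 := le_carrierMax (a + 1 + 1) l
      omega

lemma getLast?_ne_one_of_carrierEnd_eq_zero {a : ℕ} {l : List (Fin 2)} (h : carrierEnd a l = 0) :
    l.getLast? ≠ some 1 := by
  intro hl
  obtain ⟨u, rfl⟩ := List.getLast?_eq_some_iff.1 hl
  simp [carrierEnd_append, carrierEnd] at h

/-- A site is kept by the contraction if neither it is the `0` nor the `1` of a pair `(1, 0)`. -/
def keepSite (t : Fin 2 × Fin 2 × Fin 2) : Option (Fin 2) :=
  if (t.1 = 1 ∧ t.2.1 = 0) ∨ (t.2.1 = 1 ∧ t.2.2 = 0) then none else some t.2.1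

/-- `c` and `d` stand for the cyclic neighbours of the two ends. The hypotheses say that no pair
`(1, 0)` straddles an end, so the cyclic rule acts linearly. -/
lemma filterMap_keepSite_eq (c d : Fin 2) {l : List (Fin 2)} (hl : l.getLast? ≠ some 1)
    (hc : c = 1 → l.head? ≠ some 0) :
    ((c :: l).zip (l.zip (l.tail ++ [d]))).filterMap keepSite = linearContract l := by
  induction l using linearContract.induct generalizing c with
  | case1 => simp [linearContract]
  | case2 l ih =>
    have hl' : l.getLast? ≠ some 1 := by
      intro h
      exact hl (by simp [List.getLast?_cons, h])
    have hc0 : c ≠ 1 := fun h => hc h rfl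
    have := ih 0 hl' (by simp)
    cases l with
    | nil => simp [linearContract, keepSite, hc0]
    | cons z l => simpa [linearContract, keepSite, hc0] using this
  | case3 => simp at hl
  | case4 l ih =>
    have hl' : l.getLast? ≠ some 1 := by
      intro h
      exact hl (by simp [List.getLast?_cons, h])
    have := ih 0 hl' (by simp)
    cases l with
    | nil => simp [linearContract, keepSite]
    | cons z l => simpa [linearContract, keepSite] using this
  | case5 l ih =>
    have hl' : (1 :: l).getLast? ≠ some 1 := by
      intro h
      exact hl (by simpa [List.getLast?_cons] using h)
    have := ih 1 hl' (by simp)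
    simpa [linearContract, keepSite] using this

lemma cyclicPred_eq {l : List (Fin 2)} (hl : l ≠ []) :
    cyclicPred l = l.getLast hl :: l.dropLast := by
  unfold cyclicPred
  conv_lhs => rw [← List.dropLast_append_getLast hl]
  rw [show (l.dropLast ++ [l.getLast hl]).length - 1 = l.dropLast.length by simp,
    List.rotate_append_length_eq]
  rfl

lemma zip_cyclicPred {α : Type*} {l : List (Fin 2)} (hl : l ≠ []) (m : List α)
    (hm : m.length = l.length) : (cyclicPred l).zip m = (l.getLast hl :: l).zip m := by
  have e : l.getLast hl :: l = (l.getLast hl :: l.dropLast) ++ [l.getLast hl] := by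
    rw [List.cons_append, List.dropLast_append_getLast]
  have hpos := List.length_pos_iff.2 hl
  rw [cyclicPred_eq hl, e, ← List.append_nil m, List.zip_append]
  · simp
  · simp only [List.length_cons, List.length_dropLast]
    omega

/-- If the carrier starts and ends empty then the cyclic contraction is the linear one. -/
lemma contract_eq_linearContract {l : List (Fin 2)} (h : carrierEnd 0 l = 0) :
    contract l = linearContract l := by
  rcases eq_or_ne l [] with rfl | hl
  · rfl
  have hlast := getLast?_ne_one_of_carrierEnd_eq_zero h
  have hsucc : cyclicSucc l = l.tail ++ [l.head hl] := by
    cases l with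
    | nil => exact absurd rfl hl
    | cons z l => simp [cyclicSucc]
  change ((cyclicPred l).zip (l.zip (cyclicSucc l))).filterMap keepSite = _
  rw [zip_cyclicPred hl _ (by simp [cyclicSucc]), hsucc]
  refine filterMap_keepSite_eq _ _ hlast fun h' => ?_
  rw [List.getLast?_eq_some_getLast hl, h'] at hlast
  exact absurd rfl hlast

/-- Without a descent, a `1` persists up to the last letter, but a carrier that ends empty has not
just loaded a particle. -/
lemma one_notMem_of_countOneZero_eq_zero {l : List (Fin 2)} (h : carrierEnd 0 l = 0)
    (h0 : countOneZero l = 0) : (1 : Fin 2) ∉ l := by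
  rcases eq_or_ne l [] with rfl | hl
  · simp
  have hlast := getLast?_ne_one_of_carrierEnd_eq_zero h
  unfold countOneZero at h0
  rw [zip_cyclicPred hl _ rfl, List.count_eq_zero] at h0
  have key : ∀ (l : List (Fin 2)) (c : Fin 2), (1, 0) ∉ (c :: l).zip l →
      (c :: l).getLast? ≠ some 1 → (1 : Fin 2) ∉ c :: l := by
    intro l
    induction l with
    | nil => intro c _ h; simpa [eq_comm] using h
    | cons d l ih =>
      intro c h1 h2
      simp only [List.zip_cons_cons, List.mem_cons, not_or] at h1
      have := ih d h1.2 (by simpa [List.getLast?_cons] using h2)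
      simp only [List.mem_cons, not_or] at this ⊢
      refine ⟨fun hc => h1.1 ?_, this⟩
      have hd : d = 0 := by have := this.1; omega
      rw [← hc, hd]
  have := key l _ h0 (by simpa [List.getLast?_cons, List.getLast?_eq_some_getLast hl] using hlast)
  exact fun h' => this (List.mem_cons_of_mem _ h')

lemma carrierMax_eq_zero_iff {l : List (Fin 2)} : carrierMax 0 l ≤ 0 ↔ (1 : Fin 2) ∉ l := by
  induction l with
  | nil => simp [carrierMax]
  | cons z l ih =>
    fin_cases z
    · simpa [carrierMax] using ih
    · have := le_carrierMax 1 l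
      simp [carrierMax]
      omega

/-- Induction on `k`: one contraction lowers the soliton index and the height of the carrier
together, and keeps its end empty. -/
lemma solitonCount_succ_eq_zero_iff_of_carrierEnd_eq_zero {l : List (Fin 2)}
    (h : carrierEnd 0 l = 0) (k : ℕ) : solitonCount (k + 1) l = 0 ↔ carrierMax 0 l ≤ k := by
  induction k generalizing l with
  | zero =>
    rw [carrierMax_eq_zero_iff]
    exact ⟨one_notMem_of_countOneZero_eq_zero h, solitonCount_eq_zero 1⟩
  | succ k ih =>
    rw [← carrierMax_linearContract k.zero_le (getLast?_ne_one_of_carrierEnd_eq_zero h),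
      ← ih (by rwa [carrierEnd_linearContract]), ← contract_eq_linearContract h]
    rfl

/-! ### Rotation invariance -/

lemma isRotated_filterMap {α β : Type*} {l l' : List α} (h : l ~r l') (f : α → Option β) :
    l.filterMap f ~r l'.filterMap f := by
  obtain ⟨n, rfl⟩ := h
  rw [List.rotate_eq_drop_append_take_mod]
  conv_lhs => rw [← List.take_append_drop (n % l.length) l]
  rw [List.filterMap_append, List.filterMap_append]
  exact List.isRotated_append

lemma zip_rotate {α β : Type*} (l : List α) (l' : List β) (n : ℕ) (h : l.length = l'.length) :
    (l.zip l').rotate n = (l.rotate n).zip (l'.rotate n) := by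
  simpa [List.zip] using List.zipWith_rotate_distrib Prod.mk l l' n h

lemma cyclicPred_rotate (l : List (Fin 2)) (n : ℕ) :
    cyclicPred (l.rotate n) = (cyclicPred l).rotate n := by
  simp only [cyclicPred, List.length_rotate, List.rotate_rotate, add_comm]

lemma cyclicSucc_rotate (l : List (Fin 2)) (n : ℕ) :
    cyclicSucc (l.rotate n) = (cyclicSucc l).rotate n := by
  simp only [cyclicSucc, List.rotate_rotate, add_comm]

lemma isRotated_contract {l l' : List (Fin 2)} (h : l ~r l') : contract l ~r contract l' := by
  obtain ⟨n, rfl⟩ := h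
  refine isRotated_filterMap ⟨n, ?_⟩ keepSite
  rw [zip_rotate _ _ _ (by simp [cyclicPred, cyclicSucc]), zip_rotate _ _ _ (by simp [cyclicSucc]),
    cyclicPred_rotate, cyclicSucc_rotate]

lemma isRotated_iterate_contract {l l' : List (Fin 2)} (h : l ~r l') (k : ℕ) :
    contract^[k] l ~r contract^[k] l' := by
  induction k generalizing l l' with
  | zero => exact h
  | succ k ih => exact ih (isRotated_contract h)

lemma countOneZero_eq_of_isRotated {l l' : List (Fin 2)} (h : l ~r l') :
    countOneZero l = countOneZero l' := by
  obtain ⟨n, rfl⟩ := h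
  unfold countOneZero
  rw [cyclicPred_rotate, ← zip_rotate _ _ _ (by simp [cyclicPred])]
  exact ((List.rotate_perm _ n).count_eq _).symm

/-- If there are more zeros than ones, there are no solitons of size larger than `k` if and only if
the load of the cyclic carrier is at most `k`. -/
theorem solitonCount_succ_eq_zero_iff {l : List (Fin 2)} (hl : 2 * l.count 1 < l.length) (k : ℕ) :
    solitonCount (k + 1) l = 0 ↔ carrierMax (carrierEnd 0 l) l ≤ k := by
  set a := carrierEnd 0 l with ha
  have hfix : carrierEnd a l = a := (carrierEnd_eq_self_iff hl a).2 ha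
  -- The cyclic word is cut where its carrier is empty. Soliton counts and the maximum of the cyclic
  -- carrier do not notice the rotation.
  obtain ⟨u, v, huv, hu⟩ : ∃ u v, l = u ++ v ∧ carrierEnd a u = 0 := by
    have hc := count_zero_add_count_one l
    rcases carrierEnd_eq_or a l with h | ⟨h, -⟩
    · omega
    · exact h
  have hv : carrierEnd 0 v = a := by rw [← hu, ← carrierEnd_append, ← huv, hfix]
  have hrot : l ~r (v ++ u) := huv ▸ List.isRotated_append
  have h0 : carrierEnd 0 (v ++ u) = 0 := by rw [carrierEnd_append, hv, hu]
  have h1 : solitonCount (k + 1) l = solitonCount (k + 1) (v ++ u) :=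
    countOneZero_eq_of_isRotated (isRotated_iterate_contract hrot k)
  have h2 : carrierMax a l = carrierMax 0 (v ++ u) := by
    rw [huv, carrierMax_append, carrierMax_append, hu, hv, max_comm]
  rw [h1, h2]
  exact solitonCount_succ_eq_zero_iff_of_carrierEnd_eq_zero h0 k

/-! ### Convergence of the periodic Gibbs laws -/

lemma boltzmann_coe (r : ℝ) : boltzmann (r : WithTop ℝ) = ENNReal.ofReal (Real.exp (-r)) := rfl

lemma boltzmann_top : boltzmann ⊤ = 0 := rfl

/-- If the Gibbs weights are traces of matrix products, and the tilted matrix has spectral radius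
less than one, then the Gibbs laws converge to the law with the corresponding cylinder
probabilities. -/
theorem tendsto_gibbsLaw {S : Type} [Fintype S] [DecidableEq S] [Nonempty S]
    {β : ℕ → WithTop ℝ} {P : Matrix S S ℝ} {out : S → S → Fin 2} {π : S → ℝ}
    (h0 : ∀ a b, 0 ≤ P a b) (h1 : ∀ a, ∑ b, P a b = 1)
    (hπ : ∀ a b, Tendsto (fun n => (P ^ n) a b) atTop (𝓝 (π b)))
    {c : ℕ+ → ℝ} (hc : ∀ N, 0 < c N)
    (hw : ∀ (N : ℕ+) (x : Fin N → Fin 2), 2 * (List.ofFn x).count 1 < N →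
      gibbsWeight β N x =
        ENNReal.ofReal (c N * (wordProd (outputMatrix P out) (List.ofFn x)).trace))
    {θ ρ : ℝ} {v : S → ℝ} (hθ : 1 ≤ θ) (hρ0 : 0 ≤ ρ) (hρ1 : ρ < 1) (hv : ∀ a, 0 < v a)
    (hB : ∀ a, ((θ⁻¹ • outputMatrix P out 0 + θ • outputMatrix P out 1) *ᵥ v) a ≤ ρ * v a)
    {μ : ProbabilityMeasure (ℤ → Fin 2)}
    (hμ : ∀ m l, (μ : Measure (ℤ → Fin 2)).real (cyl m l) =
      ∑ b, (π ᵥ* wordProd (outputMatrix P out) l) b) :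
    Tendsto (fun N : ℕ+ => gibbsLaw β N) atTop (𝓝 μ) := by
  set M := outputMatrix P out with hM
  have hMnn : ∀ z a b, 0 ≤ M z a b := outputMatrix_nonneg h0 out
  have hsum : ∑ z, M z = P := sum_outputMatrix P out
  have htr : ∀ l, 0 ≤ (wordProd M l).trace := fun l =>
    Finset.sum_nonneg fun a _ => wordProd_nonneg hMnn l a a
  refine tendsto_of_tendsto_cyl fun m l => ?_
  rw [hμ]
  refine tendsto_periodize_cyl (M := M) (π := π) hMnn (by rw [hsum]; exact h1)
    (by rw [hsum]; exact hπ) (fun l => 2 * l.count 1 < l.length) ?_ ?_ (gibbsPMF β) ?_ m l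
  · intro l k
    rw [List.length_rotate, (l.rotate_perm k).count_eq]
  · have hBnn : ∀ a b, 0 ≤ (θ⁻¹ • M 0 + θ • M 1) a b := fun a b => by
      have := hMnn 0 a b
      have := hMnn 1 a b
      have : 0 ≤ θ := by linarith
      simp only [Matrix.add_apply, Matrix.smul_apply, smul_eq_mul]
      positivity
    have hN : Tendsto (fun N : ℕ+ => (N : ℕ)) atTop atTop := by
      refine tendsto_atTop.2 fun b => ?_
      filter_upwards [eventually_ge_atTop b.succPNat] with N h
      exact (Nat.le_succ b).trans h
    have hlim := ((tendsto_pow_atTop_nhds_zero_of_lt_one hρ0 hρ1).comp hN).const_mul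
      (Fintype.card S : ℝ)
    rw [mul_zero] at hlim
    refine squeeze_zero (fun N => Finset.sum_nonneg fun x _ => ?_) (fun N => ?_) hlim
    · split_ifs
      · exact le_rfl
      · exact htr _
    · simp only [List.length_ofFn]
      exact (sum_trace_wordProd_le hMnn hθ N).trans (trace_pow_le hBnn hv hρ0 hB N)
  · refine Eventually.of_forall fun N => ⟨c N * (∑' x, gibbsWeight β N x)⁻¹.toReal, fun x => ?_⟩
    rw [gibbsPMF, PMF.normalize_apply, ENNReal.toReal_mul, List.length_ofFn]
    split_ifs with h
    · rw [hw N x h, ENNReal.toReal_ofReal (mul_nonneg (hc N).le (htr _))]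
      ring
    · have : gibbsWeight β N x = 0 := by
        rw [gibbsWeight, if_neg]
        intro h'
        apply h
        change ((List.ofFn x).count 1 : ℝ) < _ at h'
        rw [lt_div_iff₀ two_pos] at h'
        rw [mul_comm]
        exact_mod_cast h'
      simp [this]

lemma gibbsWeight_of_lt (β : ℕ → WithTop ℝ) {N : ℕ} {x : Fin N → Fin 2}
    (h : 2 * (List.ofFn x).count 1 < N) :
    gibbsWeight β N x = boltzmann (∑ᶠ k : ℕ, solitonCount k (List.ofFn x) • β k) := by
  rw [gibbsWeight, if_pos]
  change ((List.ofFn x).count 1 : ℝ) < _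
  rw [lt_div_iff₀ two_pos, mul_comm]
  exact_mod_cast h

/-! ### The Markov configuration -/

section markov
variable {p₀ p₁ : ℝ} (hp₀ : 0 < p₀) (hp₀' : p₀ < 1) (hp₁ : 0 < p₁) (hp₁' : p₁ < 1)
include hp₀ hp₀' hp₁ hp₁'

lemma markovMatrix_pos (a b : Fin 2) : 0 < markovMatrix p₀ p₁ a b := by
  fin_cases a <;> fin_cases b <;> simp [markovMatrix] <;> assumption

omit hp₀ hp₀' hp₁ hp₁' in
lemma markovMatrix_sum (a : Fin 2) : ∑ b, markovMatrix p₀ p₁ a b = 1 := by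
  fin_cases a <;> simp [markovMatrix]

omit hp₁' in
-- The word forces the path, so the entry is one product of transition probabilities. Counting only
-- ones and descents leaves a boundary factor, which telescopes and disappears on closed paths,
-- where ascents and descents are equally many.
lemma wordProd_markovMatrix (l : List (Fin 2)) (a b : Fin 2) :
    wordProd (outputMatrix (markovMatrix p₀ p₁) fun _ b => b) l a b =
      if (a :: l).getLast (List.cons_ne_nil a l) = b then
        (1 - p₀) ^ l.length * (p₁ / (1 - p₀)) ^ l.count 1 *
          (p₀ * (1 - p₁) / (p₁ * (1 - p₀))) ^ ((a :: l).zip l).count (1, 0) *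
            ((if a = 1 then p₁ else p₀) / (if b = 1 then p₁ else p₀)) else 0 := by
  have hq : 0 < 1 - p₀ := by linarith
  induction l generalizing a with
  | nil =>
    rw [wordProd_nil, Matrix.one_apply]
    have hb : (if b = 1 then p₁ else p₀) ≠ 0 := by
      split_ifs
      · exact hp₁.ne'
      · exact hp₀.ne'
    by_cases h : a = b
    · subst h
      simp [div_self hb]
    · simp [h]
  | cons z l ih =>
    rw [wordProd_cons, Matrix.mul_apply, Finset.sum_eq_single z, ih, List.getLast_cons_cons]
    · simp only [outputMatrix, if_true]
      rw [mul_ite, mul_zero]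
      refine if_congr Iff.rfl ?_ rfl
      fin_cases a <;> fin_cases z <;> simp [markovMatrix, pow_succ] <;> field_simp
    · intro c _ hc
      simp [outputMatrix, hc]
    · simp

omit hp₁' in
lemma trace_wordProd_markovMatrix {l : List (Fin 2)} (hl : l ≠ []) :
    (wordProd (outputMatrix (markovMatrix p₀ p₁) fun _ b => b) l).trace =
      (1 - p₀) ^ l.length * (p₁ / (1 - p₀)) ^ l.count 1 *
          (p₀ * (1 - p₁) / (p₁ * (1 - p₀))) ^ countOneZero l := by
  simp only [Matrix.trace, Matrix.diag, wordProd_markovMatrix hp₀ hp₀' hp₁,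
    List.getLast_cons hl]
  rw [Finset.sum_ite_eq, if_pos (Finset.mem_univ _), countOneZero, zip_cyclicPred hl _ rfl,
    div_self, mul_one]
  split_ifs
  · exact hp₁.ne'
  · exact hp₀.ne'

lemma gibbsWeight_markovParam (N : ℕ+) (x : Fin N → Fin 2) (h : 2 * (List.ofFn x).count 1 < N) :
    gibbsWeight (markovParam p₀ p₁) N x = ENNReal.ofReal (((1 - p₀) ^ (N : ℕ))⁻¹ *
      (wordProd (outputMatrix (markovMatrix p₀ p₁) fun _ b => b) (List.ofFn x)).trace) := by
  have hq : 0 < 1 - p₀ := by linarith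
  have hq' : 0 < 1 - p₁ := by linarith
  have hne : List.ofFn x ≠ [] := by
    intro h'
    have := congrArg List.length h'
    simp at this
  rw [gibbsWeight_of_lt _ h, finsum_eq_sum_of_support_subset (s := {0, 1})]
  · rw [Finset.sum_pair zero_ne_one, trace_wordProd_markovMatrix hp₀ hp₀' hp₁ hne,
      List.length_ofFn]
    set l := List.ofFn x
    change boltzmann (l.count 1 • ((Real.log ((1 - p₀) / p₁) : ℝ) : WithTop ℝ) +
      countOneZero l •
        ((Real.log (p₁ * (1 - p₀) / (p₀ * (1 - p₁))) : ℝ) : WithTop ℝ)) = _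
    rw [← WithTop.coe_nsmul, ← WithTop.coe_nsmul, ← WithTop.coe_add, boltzmann_coe]
    congr 1
    rw [neg_add, Real.exp_add, nsmul_eq_mul, nsmul_eq_mul, ← mul_neg, ← mul_neg, ← Real.log_inv,
      ← Real.log_inv, inv_div, inv_div, Real.exp_nat_mul, Real.exp_nat_mul, Real.exp_log,
      Real.exp_log, ← mul_assoc, ← mul_assoc, inv_mul_cancel₀ (pow_pos hq _).ne', one_mul]
    · positivity
    · positivity
  · intro k hk
    match k with
    | 0 => simp
    | 1 => simp
    | k + 2 => simp [markovParam] at hk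

lemma tendsto_gibbsLaw_markovParam (hp : p₀ + p₁ < 1) {π : Fin 2 → ℝ}
    (hπ : ∀ a b, Tendsto (fun n => (markovMatrix p₀ p₁ ^ n) a b) atTop (𝓝 (π b)))
    {μ : ProbabilityMeasure (ℤ → Fin 2)}
    (hμ : ∀ m l, (μ : Measure (ℤ → Fin 2)).real (cyl m l) =
      ∑ b, (π ᵥ* wordProd (outputMatrix (markovMatrix p₀ p₁) fun _ b => b) l) b) :
    Tendsto (fun N : ℕ+ => gibbsLaw (markovParam p₀ p₁) N) atTop (𝓝 μ) := by
  have hq : 0 < 1 - p₀ := by linarith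
  have hq' : 0 < 1 - p₁ := by linarith
  -- Square roots of the four transition probabilities. The tilt `θ = x / y` makes both diagonal
  -- entries equal to `x * y`; the tilted matrix then has eigenvalue `x * y + z * w` with
  -- eigenvector `![z * x, y * w]`.
  obtain ⟨x, hx, hx2⟩ : ∃ x : ℝ, 0 < x ∧ x ^ 2 = 1 - p₀ :=
    ⟨_, Real.sqrt_pos.2 hq, Real.sq_sqrt hq.le⟩
  obtain ⟨y, hy, hy2⟩ : ∃ x : ℝ, 0 < x ∧ x ^ 2 = p₁ := ⟨_, Real.sqrt_pos.2 hp₁, Real.sq_sqrt hp₁.le⟩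
  obtain ⟨z, hz, hz2⟩ : ∃ x : ℝ, 0 < x ∧ x ^ 2 = p₀ := ⟨_, Real.sqrt_pos.2 hp₀, Real.sq_sqrt hp₀.le⟩
  obtain ⟨w, hw, hw2⟩ : ∃ x : ℝ, 0 < x ∧ x ^ 2 = 1 - p₁ :=
    ⟨_, Real.sqrt_pos.2 hq', Real.sq_sqrt hq'.le⟩
  have hyx : y < x := by nlinarith
  refine tendsto_gibbsLaw (fun a b => (markovMatrix_pos hp₀ hp₀' hp₁ hp₁' a b).le)
    markovMatrix_sum hπ (fun N => inv_pos.2 (pow_pos hq (N : ℕ)))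
    (gibbsWeight_markovParam hp₀ hp₀' hp₁ hp₁') (θ := x / y) (ρ := x * y + z * w)
    (v := ![z * x, y * w]) ((one_le_div hy).2 hyx.le) (by positivity) ?_ ?_ ?_ hμ
  -- Twice the eigenvalue is below the sum of the four squares, which is two; the inequality is
  -- strict because `y < x`, that is, `p₀ + p₁ < 1`.
  · nlinarith [sq_pos_of_pos (sub_pos.2 hyx), sq_nonneg (z - w)]
  · intro a
    fin_cases a
    · exact mul_pos hz hx
    · exact mul_pos hy hw
  · intro a
    apply le_of_eq
    fin_cases a
    · simp [Matrix.mulVec, dotProduct, outputMatrix, markovMatrix]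
      rw [← hx2, ← hz2]
      field_simp
    · simp [Matrix.mulVec, dotProduct, outputMatrix, markovMatrix]
      rw [← hw2, ← hy2]
      field_simp
      ring

end markov

/-! ### The i.i.d. configuration as the Markov configuration with equal rows. -/

lemma iidParam_eq_markovParam {p : ℝ} (h0 : 0 < p) (h1 : p < 1) :
    iidParam p = markovParam p p := by
  have hq : 0 < 1 - p := by linarith
  funext k
  match k with
  | 0 => rfl
  | 1 =>
    have : p * (1 - p) / (p * (1 - p)) = 1 := div_self (by positivity)
    simp [iidParam, markovParam, this]
  | k + 2 => rfl

lemma sum_wordProd_iid (p : ℝ) (l : List (Fin 2)) (a : Fin 2) :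
    ∑ b, wordProd (outputMatrix (markovMatrix p p) fun _ b => b) l a b =
      (l.map fun z => if z = 1 then p else 1 - p).prod := by
  induction l generalizing a with
  | nil => simp [Matrix.one_apply]
  | cons z l ih =>
    simp only [wordProd_cons, Matrix.mul_apply]
    rw [Finset.sum_comm]
    simp only [← Finset.mul_sum, ih, List.map_cons, List.prod_cons, ← Finset.sum_mul]
    congr 1
    fin_cases a <;> fin_cases z <;> simp [outputMatrix, markovMatrix]

theorem tendsto_gibbsLaw_iidParam (p : unitInterval) (h0 : 0 < (p : ℝ)) (h1 : (p : ℝ) < 1 / 2) :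
    Tendsto (fun N : ℕ+ => gibbsLaw (iidParam p) N) atTop (𝓝 (iidLaw p)) := by
  have h1' : (p : ℝ) < 1 := by linarith
  have hpos := markovMatrix_pos h0 h1' h0 h1'
  obtain ⟨π, hπ⟩ := tendsto_pow_of_stochastic (P := markovMatrix p p) (m := 1)
    (fun a b => (hpos a b).le) markovMatrix_sum (by simpa using hpos)
  rw [iidParam_eq_markovParam h0 h1']
  refine tendsto_gibbsLaw_markovParam h0 h1' h0 h1' (by linarith) hπ fun m l => ?_
  rw [iidLaw_cyl]
  simp only [Matrix.vecMul, dotProduct]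
  rw [Finset.sum_comm]
  simp only [← Finset.mul_sum, sum_wordProd_iid, ← Finset.sum_mul,
    (limit_of_stochastic markovMatrix_sum hπ).1, one_mul]

/-! ### The bounded soliton configuration -/

/-- The output of a carrier transition: a particle is picked up. -/
def carrierOut (K : ℕ) (a b : Fin (K + 1)) : Fin 2 := if (b : ℕ) = (a : ℕ) + 1 then 1 else 0

section primitive
variable {K : ℕ} {A : Matrix (Fin (K + 1)) (Fin (K + 1)) ℝ}

lemma mul_apply_pos {S : Type*} [Fintype S] {X Y : Matrix S S ℝ} (hX : ∀ a b, 0 ≤ X a b)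
    (hY : ∀ a b, 0 ≤ Y a b) {a b c : S} (h1 : 0 < X a c) (h2 : 0 < Y c b) : 0 < (X * Y) a b := by
  rw [Matrix.mul_apply]
  exact Finset.sum_pos' (fun d _ => mul_nonneg (hX a d) (hY d b))
    ⟨c, Finset.mem_univ c, mul_pos h1 h2⟩

/-- A nearest-neighbour matrix with a positive diagonal entry is primitive. -/
lemma pow_pos_of_nearest_neighbour (h0 : ∀ a b, 0 ≤ A a b)
    (hup : ∀ a b : Fin (K + 1), (b : ℕ) = a + 1 → 0 < A a b)
    (hdown : ∀ a b : Fin (K + 1), (a : ℕ) = b + 1 → 0 < A a b) (hstay : 0 < A 0 0)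
    (a b : Fin (K + 1)) : 0 < (A ^ (K + K)) a b := by
  have hpow : ∀ n a b, 0 ≤ (A ^ n) a b := fun n a b => Matrix.pow_apply_nonneg h0 n a b
  -- Any state reaches `0` within `K` steps and any state is reached from `0` within `K`; spare time
  -- is spent waiting at `0`.
  have h1 : ∀ (n : ℕ) (a : Fin (K + 1)), (a : ℕ) ≤ n → 0 < (A ^ n) a 0 := by
    intro n
    induction n with
    | zero =>
      intro a ha
      obtain rfl : a = 0 := Fin.ext (by simpa using ha)
      simp
    | succ n ih =>
      intro a ha
      rw [pow_succ']
      rcases Nat.eq_zero_or_pos (a : ℕ) with h | h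
      · obtain rfl : a = 0 := Fin.ext h
        exact mul_apply_pos h0 (hpow n) hstay (ih 0 (by simp))
      · exact mul_apply_pos h0 (hpow n)
          (hdown a ⟨(a : ℕ) - 1, by omega⟩ (by simp only; omega)) (ih _ (by simp only; omega))
  have h2 : ∀ (n : ℕ) (b : Fin (K + 1)), (b : ℕ) ≤ n → 0 < (A ^ n) 0 b := by
    intro n
    induction n with
    | zero =>
      intro b hb
      obtain rfl : b = 0 := Fin.ext (by simpa using hb)
      simp
    | succ n ih =>
      intro b hb
      rw [pow_succ]
      rcases Nat.eq_zero_or_pos (b : ℕ) with h | h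
      · obtain rfl : b = 0 := Fin.ext h
        exact mul_apply_pos (hpow n) h0 (ih 0 (by simp)) hstay
      · exact mul_apply_pos (hpow n) h0 (ih ⟨(b : ℕ) - 1, by omega⟩ (by simp only; omega))
          (hup _ b (by simp only; omega))
  rw [pow_add]
  exact mul_apply_pos (hpow K) (hpow K) (h1 K a (by omega)) (h2 K b (by omega))

end primitive

section bounded
variable {p : ℝ} {K : ℕ}

/-- Truncated subtraction merges the step down with the stay at `0`, as in `carrierStep`. -/
lemma carrierMatrix_apply (a b : Fin (K + 1)) : carrierMatrix p K a b =
    if (b : ℕ) = a + 1 then p else if (b : ℕ) = a - 1 then 1 - p else 0 := by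
  simp only [carrierMatrix, Matrix.of_apply, carrierTransition]
  split_ifs <;> first | rfl | omega

variable (hp0 : 0 < p) (hp1 : p < 1)
include hp0 hp1

lemma carrierMatrix_nonneg (a b : Fin (K + 1)) : 0 ≤ carrierMatrix p K a b := by
  rw [carrierMatrix_apply]
  split_ifs <;> linarith

lemma carrierMatrix_pos {a b : Fin (K + 1)}
    (h : (b : ℕ) = a + 1 ∨ (b : ℕ) = a - 1) : 0 < carrierMatrix p K a b := by
  rw [carrierMatrix_apply]
  split_ifs
  · exact hp0
  · linarith
  · omega

theorem exists_isCarrierEigenvector : ∃ h, IsCarrierEigenvector p K h := by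
  have h0 := carrierMatrix_nonneg (K := K) hp0 hp1
  obtain ⟨h, Λ, hΛ, hh, heig⟩ := exists_pos_eigenvector h0
    (pow_pos_of_nearest_neighbour h0 (fun a b hab => carrierMatrix_pos hp0 hp1 (Or.inl hab))
      (fun a b hab => carrierMatrix_pos hp0 hp1 (Or.inr (by omega)))
      (carrierMatrix_pos hp0 hp1 (Or.inr rfl)))
  refine ⟨h, hh, ?_⟩
  rw [heig, carrierEigenvalue, spectralRadius_eq_of_pos_eigenvector h0 hΛ hh heig]

variable {h : Fin (K + 1) → ℝ} (hh : IsCarrierEigenvector p K h)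
include hh

lemma IsCarrierEigenvector.eigenvalue_pos : 0 < carrierEigenvalue p K := by
  have e := congrFun hh.2 0
  have : 0 < (carrierMatrix p K *ᵥ h) 0 := Finset.sum_pos'
    (fun b _ => mul_nonneg (carrierMatrix_nonneg hp0 hp1 0 b) (hh.1 b).le)
    ⟨0, Finset.mem_univ 0, mul_pos (carrierMatrix_pos hp0 hp1 (Or.inr rfl)) (hh.1 0)⟩
  rw [e, Pi.smul_apply, smul_eq_mul] at this
  exact pos_of_mul_pos_left this (hh.1 0).le

lemma transformedCarrierMatrix_nonneg (a b : Fin (K + 1)) :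
    0 ≤ transformedCarrierMatrix p K h a b :=
  div_nonneg (mul_nonneg (carrierMatrix_nonneg hp0 hp1 a b) (hh.1 b).le)
    (mul_pos (hh.eigenvalue_pos hp0 hp1) (hh.1 a)).le

lemma transformedCarrierMatrix_pos {a b : Fin (K + 1)}
    (hab : (b : ℕ) = a + 1 ∨ (b : ℕ) = a - 1) : 0 < transformedCarrierMatrix p K h a b :=
  div_pos (mul_pos (carrierMatrix_pos hp0 hp1 hab) (hh.1 b))
    (mul_pos (hh.eigenvalue_pos hp0 hp1) (hh.1 a))

lemma transformedCarrierMatrix_sum (a : Fin (K + 1)) :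
    ∑ b, transformedCarrierMatrix p K h a b = 1 := by
  have e := congrFun hh.2 a
  simp only [Matrix.mulVec, dotProduct, Pi.smul_apply, smul_eq_mul] at e
  simp only [transformedCarrierMatrix, Matrix.of_apply, ← Finset.sum_div, e]
  exact div_self (mul_pos (hh.eigenvalue_pos hp0 hp1) (hh.1 a)).ne'

lemma exists_tendsto_transformedCarrierMatrix_pow : ∃ π : Fin (K + 1) → ℝ,
    ∀ a b, Tendsto (fun n => (transformedCarrierMatrix p K h ^ n) a b) atTop (𝓝 (π b)) :=
  tendsto_pow_of_stochastic (transformedCarrierMatrix_nonneg hp0 hp1 hh)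
    (transformedCarrierMatrix_sum hp0 hp1 hh)
    (pow_pos_of_nearest_neighbour (transformedCarrierMatrix_nonneg hp0 hp1 hh)
      (fun a b hab => transformedCarrierMatrix_pos hp0 hp1 hh (Or.inl hab))
      (fun a b hab => transformedCarrierMatrix_pos hp0 hp1 hh (Or.inr (by omega)))
      (transformedCarrierMatrix_pos hp0 hp1 hh (Or.inr rfl)))

omit hp0 hp1 hh in
lemma outputMatrix_transformedCarrierMatrix (z : Fin 2) (a b : Fin (K + 1)) :
    outputMatrix (transformedCarrierMatrix p K h) (carrierOut K) z a b =
      if carrierStep a z = b then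
        (if z = 1 then p else 1 - p) * h b / (carrierEigenvalue p K * h a) else 0 := by
  simp only [outputMatrix, carrierOut, transformedCarrierMatrix, Matrix.of_apply,
    carrierMatrix_apply]
  fin_cases z
  · simp only [Fin.zero_eta, carrierStep_zero, zero_ne_one, if_false]
    by_cases h1 : (b : ℕ) = a + 1
    · have h2 : ¬ ((a : ℕ) - 1 = b) := by omega
      simp [h1]
    · by_cases h2 : (b : ℕ) = a - 1
      · simp [h2]
      · simp [h1, h2, Ne.symm h2]
  · simp only [Fin.mk_one, carrierStep_one, if_true]
    by_cases h1 : (b : ℕ) = a + 1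
    · simp [h1]
    · simp [h1, Ne.symm h1]

/-- The word and the initial load determine the carrier path; the entry vanishes if the path leaves
`{0, …, K}`, and the factors `h` telescope. -/
lemma wordProd_transformedCarrierMatrix (l : List (Fin 2)) (a b : Fin (K + 1)) :
    wordProd (outputMatrix (transformedCarrierMatrix p K h) (carrierOut K)) l a b =
      if carrierEnd a l = b ∧ carrierMax a l ≤ K then
        p ^ l.count 1 * (1 - p) ^ l.count 0 / carrierEigenvalue p K ^ l.length * (h b / h a)
      else 0 := by
  have hΛ := hh.eigenvalue_pos hp0 hp1
  induction l generalizing a with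
  | nil =>
    have ha : (a : ℕ) ≤ K := by omega
    simp only [wordProd_nil, Matrix.one_apply, carrierEnd, carrierMax, ha, and_true, Fin.val_inj]
    split_ifs with hab
    · subst hab
      simp [(hh.1 a).ne']
    · rfl
  | cons z l ih =>
    have ha : (a : ℕ) ≤ K := by omega
    rw [wordProd_cons, Matrix.mul_apply]
    simp only [outputMatrix_transformedCarrierMatrix, carrierEnd, carrierMax, max_le_iff, ha,
      true_and]
    by_cases hs : carrierStep a z ≤ K
    · rw [Finset.sum_eq_single ⟨carrierStep a z, by omega⟩, if_pos rfl, ih, mul_ite, mul_zero]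
      · refine if_congr Iff.rfl ?_ rfl
        have := (hh.1 a).ne'
        have := (hh.1 b).ne'
        have hr := (hh.1 ⟨carrierStep a z, by omega⟩).ne'
        generalize h ⟨carrierStep a z, _⟩ = r at hr ⊢
        fin_cases z
        · simp only [Fin.zero_eta, zero_ne_one, if_false, List.count_cons_self,
            List.count_cons_of_ne (show (0 : Fin 2) ≠ 1 by decide), List.length_cons, pow_succ]
          field_simp
        · simp only [Fin.mk_one, if_true, List.count_cons_self,
            List.count_cons_of_ne (show (1 : Fin 2) ≠ 0 by decide), List.length_cons, pow_succ]
          field_simp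
      · intro c _ hc
        rw [if_neg, zero_mul]
        exact fun h' => hc (Fin.ext h'.symm)
      · simp
    · have hn : ¬(carrierEnd (carrierStep a z) l = b ∧ carrierMax (carrierStep a z) l ≤ K) :=
        fun h' => hs ((le_carrierMax _ _).trans h'.2)
      rw [if_neg hn]
      refine Finset.sum_eq_zero fun c _ => ?_
      rw [if_neg, zero_mul]
      have := c.2
      omega

/-- The surplus of zeros leaves a single closed carrier path, so at most one diagonal entry is
nonzero. -/
lemma trace_wordProd_transformedCarrierMatrix {l : List (Fin 2)}
    (hl : 2 * l.count 1 < l.length) :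
    (wordProd (outputMatrix (transformedCarrierMatrix p K h) (carrierOut K)) l).trace =
      if carrierMax (carrierEnd 0 l) l ≤ K then
        p ^ l.count 1 * (1 - p) ^ l.count 0 / carrierEigenvalue p K ^ l.length else 0 := by
  simp only [Matrix.trace, Matrix.diag, wordProd_transformedCarrierMatrix hp0 hp1 hh,
    carrierEnd_eq_self_iff hl]
  split_ifs with hK
  · have hlt : carrierEnd 0 l < K + 1 := Nat.lt_succ_of_le ((le_carrierMax _ _).trans hK)
    rw [Finset.sum_eq_single ⟨carrierEnd 0 l, hlt⟩]
    · rw [if_pos ⟨rfl, hK⟩, div_self (hh.1 _).ne', mul_one]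
    · intro a _ ha
      rw [if_neg]
      exact fun h' => ha (Fin.ext h'.1)
    · simp
  · refine Finset.sum_eq_zero fun a _ => if_neg ?_
    rintro ⟨h1, h2⟩
    rw [h1] at h2
    exact hK h2

lemma gibbsWeight_boundedParam (N : ℕ+) (x : Fin N → Fin 2) (hx : 2 * (List.ofFn x).count 1 < N) :
    gibbsWeight (boundedParam p K) N x =
      ENNReal.ofReal ((carrierEigenvalue p K / (1 - p)) ^ (N : ℕ) *
      (wordProd (outputMatrix (transformedCarrierMatrix p K h) (carrierOut K))
        (List.ofFn x)).trace) := by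
  have hq : 0 < 1 - p := by linarith
  have hΛ := hh.eigenvalue_pos hp0 hp1
  have hx' : 2 * (List.ofFn x).count 1 < (List.ofFn x).length := by rwa [List.length_ofFn]
  have hlen : (List.ofFn x).length = N := List.length_ofFn
  rw [gibbsWeight_of_lt _ hx, trace_wordProd_transformedCarrierMatrix hp0 hp1 hh hx']
  set l := List.ofFn x with hl
  split_ifs with hK
  · have hzero : ∀ k, k ≠ 0 → solitonCount k l • boundedParam p K k = 0 := by
      intro k hk
      obtain ⟨k, rfl⟩ := Nat.exists_eq_succ_of_ne_zero hk
      by_cases hkK : k + 1 ≤ K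
      · rw [boundedParam, if_neg hk, if_pos hkK, smul_zero]
      · rw [(solitonCount_succ_eq_zero_iff hx' k).2 (by omega), zero_smul]
    rw [finsum_eq_single _ 0 hzero]
    change boltzmann (l.count 1 • ((Real.log ((1 - p) / p) : ℝ) : WithTop ℝ)) = _
    rw [← WithTop.coe_nsmul, boltzmann_coe]
    congr 1
    rw [nsmul_eq_mul, ← mul_neg, ← Real.log_inv, inv_div, Real.exp_nat_mul,
      Real.exp_log (div_pos hp0 hq), ← hlen, ← count_zero_add_count_one l, div_pow, div_pow, pow_add (1 - p)]
    field_simp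
  · rw [mul_zero, ENNReal.ofReal_zero]
    set f : ℕ → WithTop ℝ := fun k => solitonCount k l • boundedParam p K k with hf
    -- Finite support is needed: `finsum` would return zero otherwise and hide the infinite term.
    have hsupp : Function.support f ⊆ (Finset.range (carrierMax (carrierEnd 0 l) l + 1) : Set ℕ) := by
      intro k hk
      by_contra hk'
      simp only [Finset.coe_range, Set.mem_Iio, not_lt] at hk'
      obtain ⟨k, rfl⟩ : ∃ j, k = j + 1 := ⟨k - 1, by omega⟩
      exact hk (by simp only [hf, (solitonCount_succ_eq_zero_iff hx' k).2 (by omega), zero_smul])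
    have htop : f (K + 1) = ⊤ := by
      have hne : solitonCount (K + 1) l ≠ 0 := fun h' =>
        hK ((solitonCount_succ_eq_zero_iff hx' K).1 h')
      obtain ⟨n, hn⟩ := Nat.exists_eq_succ_of_ne_zero hne
      simp only [hf, hn, boundedParam]
      rw [if_neg (Nat.succ_ne_zero K), if_neg (by omega), Nat.succ_eq_add_one, succ_nsmul,
        WithTop.add_top]
    rw [finsum_eq_sum_of_support_subset f hsupp]
    have : ∑ k ∈ Finset.range (carrierMax (carrierEnd 0 l) l + 1), f k = ⊤ := by
      rw [WithTop.sum_eq_top]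
      exact ⟨K + 1, Finset.mem_range.2 (by omega), htop⟩
    rw [this, boltzmann_top]

/-! ### Spectral estimate for the tilted carrier. -/

/-- The tilt by powers of `θ` of a nonnegative function on loads is subharmonic. -/
lemma tilted_mulVec_le {u : ℕ → ℝ} {κ : ℝ} (hu : u (K + 1) = 0)
    (hstep : ∀ n, p * u (n + 1) + (1 - p) * (if n = 0 then 0 else u (n - 1)) = κ * u n)
    (hpos : ∀ n ≤ K, 0 < u n) {θ : ℝ} (hθ : 0 < θ) (a : Fin (K + 1)) :
    ((θ⁻¹ • outputMatrix (transformedCarrierMatrix p K h) (carrierOut K) 0 +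
      θ • outputMatrix (transformedCarrierMatrix p K h) (carrierOut K) 1) *ᵥ
        fun b => (θ ^ (b : ℕ))⁻¹ * u b / h b) a ≤
      ((κ + (1 - p) / θ) / carrierEigenvalue p K) * ((θ ^ (a : ℕ))⁻¹ * u a / h a) := by
  have hΛ := hh.eigenvalue_pos hp0 hp1
  have hq : 0 < 1 - p := by linarith
  have ha := hh.1 a
  have hcomp : ((θ⁻¹ • outputMatrix (transformedCarrierMatrix p K h) (carrierOut K) 0 +
      θ • outputMatrix (transformedCarrierMatrix p K h) (carrierOut K) 1) *ᵥ
        fun b => (θ ^ (b : ℕ))⁻¹ * u b / h b) a =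
      (θ⁻¹ * (1 - p) * ((θ ^ ((a : ℕ) - 1))⁻¹ * u ((a : ℕ) - 1)) +
        θ * p * ((θ ^ ((a : ℕ) + 1))⁻¹ * u ((a : ℕ) + 1))) / (carrierEigenvalue p K * h a) := by
    have e : ∀ b : Fin (K + 1),
        (θ⁻¹ • outputMatrix (transformedCarrierMatrix p K h) (carrierOut K) 0 +
          θ • outputMatrix (transformedCarrierMatrix p K h) (carrierOut K) 1) a b *
          ((θ ^ (b : ℕ))⁻¹ * u b / h b) =
        (if (a : ℕ) - 1 = b then θ⁻¹ * (1 - p) * ((θ ^ (b : ℕ))⁻¹ * u b) /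
          (carrierEigenvalue p K * h a) else 0) +
        (if (a : ℕ) + 1 = b then θ * p * ((θ ^ (b : ℕ))⁻¹ * u b) /
          (carrierEigenvalue p K * h a) else 0) := by
      intro b
      have := hh.1 b
      simp only [Matrix.add_apply, Matrix.smul_apply, smul_eq_mul,
        outputMatrix_transformedCarrierMatrix, carrierStep_zero, carrierStep_one, add_mul]
      congr 1 <;> split_ifs <;> first | (field_simp; done) | simp_all
    simp only [Matrix.mulVec, dotProduct, e, Finset.sum_add_distrib]
    rw [add_div]
    congr 1
    · rw [Finset.sum_eq_single ⟨(a : ℕ) - 1, by omega⟩, if_pos rfl]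
      · intro b _ hb
        exact if_neg fun h' => hb (Fin.ext h'.symm)
      · simp
    · rcases Nat.lt_or_ge (a : ℕ) K with haK | haK
      · rw [Finset.sum_eq_single ⟨(a : ℕ) + 1, by omega⟩, if_pos rfl]
        · intro b _ hb
          exact if_neg fun h' => hb (Fin.ext h'.symm)
        · simp
      · have haK' : (a : ℕ) + 1 = K + 1 := by omega
        rw [haK', hu]
        simp only [mul_zero, zero_div]
        exact Finset.sum_eq_zero fun b _ => if_neg (by omega)
  -- The weights `θ ^ (-a)` absorb the tilt on every step up or down. Only the stay at `0` keeps a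
  -- factor `θ⁻¹`, which produces the extra term `(1 - p) / θ`.
  rw [hcomp, div_mul_div_comm]
  refine div_le_div_of_nonneg_right ?_ (mul_pos hΛ ha).le
  have hs := hstep a
  rcases Nat.eq_zero_or_pos (a : ℕ) with h0 | h0
  · rw [h0] at hs ⊢
    simp only [if_true, mul_zero, add_zero, zero_add] at hs
    simp only [zero_tsub, pow_zero, inv_one, one_mul, zero_add, pow_one, add_mul, ← hs]
    apply le_of_eq
    field_simp
    ring
  · obtain ⟨n, hn⟩ : ∃ n, (a : ℕ) = n + 1 := ⟨(a : ℕ) - 1, by omega⟩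
    have hua := hpos a (by omega)
    rw [hn] at hs hua ⊢
    rw [if_neg (Nat.succ_ne_zero n), Nat.add_sub_cancel] at hs
    rw [Nat.add_sub_cancel]
    have e1 : θ⁻¹ * (1 - p) * ((θ ^ n)⁻¹ * u n) + θ * p * ((θ ^ (n + 1 + 1))⁻¹ * u (n + 1 + 1)) =
        (θ ^ (n + 1))⁻¹ * (p * u (n + 1 + 1) + (1 - p) * u n) := by
      simp only [pow_succ]
      field_simp
      ring
    rw [e1, hs]
    have : 0 ≤ (θ ^ (n + 1))⁻¹ * ((1 - p) / θ * u (n + 1)) := by positivity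
    linarith

/-- A positive eigenfunction of the carrier killed when it stays at zero has a smaller
eigenvalue. -/
lemma lt_carrierEigenvalue {u : ℕ → ℝ} {κ : ℝ} (hu : u (K + 1) = 0)
    (hstep : ∀ n, p * u (n + 1) + (1 - p) * (if n = 0 then 0 else u (n - 1)) = κ * u n)
    (hpos : ∀ n ≤ K, 0 < u n) : κ < carrierEigenvalue p K := by
  have hq : 0 < 1 - p := by linarith
  set r : ℝ := p / (1 - p) with hr
  have hr0 : 0 < r := div_pos hp0 hq
  have hPu : ∀ a : Fin (K + 1), ∑ b, carrierMatrix p K a b * u b =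
      κ * u a + if (a : ℕ) = 0 then (1 - p) * u 0 else 0 := by
    intro a
    have e : ∀ b : Fin (K + 1), carrierMatrix p K a b * u b =
        (if (a : ℕ) + 1 = b then p * u b else 0) +
          (if (a : ℕ) - 1 = b then (1 - p) * u b else 0) := by
      intro b
      rw [carrierMatrix_apply]
      split_ifs <;> first | omega | simp
    have e1 : ∑ b : Fin (K + 1), (if (a : ℕ) + 1 = b then p * u b else 0) = p * u (a + 1) := by
      rcases Nat.lt_or_ge (a : ℕ) K with haK | haK
      · rw [Finset.sum_eq_single ⟨(a : ℕ) + 1, by omega⟩, if_pos rfl]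
        · intro b _ hb
          exact if_neg fun h' => hb (Fin.ext h'.symm)
        · simp
      · have haK' : (a : ℕ) + 1 = K + 1 := by omega
        rw [haK', hu, mul_zero]
        exact Finset.sum_eq_zero fun b _ => if_neg (by omega)
    have e2 : ∑ b : Fin (K + 1), (if (a : ℕ) - 1 = b then (1 - p) * u b else 0) =
        (1 - p) * u (a - 1) := by
      rw [Finset.sum_eq_single ⟨(a : ℕ) - 1, by omega⟩, if_pos rfl]
      · intro b _ hb
        exact if_neg fun h' => hb (Fin.ext h'.symm)
      · simp
    simp only [e, Finset.sum_add_distrib, e1, e2, ← hstep a]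
    split_ifs with h0
    · simp [h0]
    · ring
  -- Detailed balance: the carrier is reversible with respect to the weights `r ^ a`.
  have hsymm : ∀ a b : Fin (K + 1), r ^ (a : ℕ) * carrierMatrix p K a b =
      r ^ (b : ℕ) * carrierMatrix p K b a := by
    have hrq : r * (1 - p) = p := div_mul_cancel₀ _ hq.ne'
    intro a b
    rw [carrierMatrix_apply, carrierMatrix_apply]
    by_cases h1 : (b : ℕ) = a + 1
    · have h2 : ¬((a : ℕ) = b + 1) := by omega
      have h3 : (a : ℕ) = b - 1 := by omega
      rw [if_pos h1, if_neg h2, if_pos h3, h1, pow_succ, mul_assoc, hrq]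
    · by_cases h2 : (a : ℕ) = b + 1
      · have h3 : (b : ℕ) = a - 1 := by omega
        rw [if_neg h1, if_pos h3, if_pos h2, h2, pow_succ, mul_assoc, hrq]
      · rw [if_neg h1, if_neg h2]
        by_cases h3 : (a : ℕ) = 0 ∧ (b : ℕ) = 0
        · simp [h3.1, h3.2]
        · have h4 : ¬((b : ℕ) = a - 1) := by omega
          have h5 : ¬((a : ℕ) = b - 1) := by omega
          rw [if_neg h4, if_neg h5, mul_zero, mul_zero]
  -- Pairing the image of `u` with `h` in the reversible weights gives the carrier eigenvalue times
  -- the pairing of `u` and `h`. Computed from `u` it gives `κ` times that pairing plus a positive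
  -- term at `0`, so `κ` is smaller.
  have hpair : ∑ a : Fin (K + 1), r ^ (a : ℕ) * h a * (∑ b, carrierMatrix p K a b * u b) =
      carrierEigenvalue p K * ∑ a : Fin (K + 1), r ^ (a : ℕ) * h a * u a := by
    have hPh : ∀ b, ∑ a, carrierMatrix p K b a * h a = carrierEigenvalue p K * h b :=
      fun b => congrFun hh.2 b
    calc _ = ∑ a : Fin (K + 1), ∑ b : Fin (K + 1),
          r ^ (b : ℕ) * u b * (carrierMatrix p K b a * h a) := by
          refine Finset.sum_congr rfl fun a _ => ?_
          rw [Finset.mul_sum]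
          refine Finset.sum_congr rfl fun b _ => ?_
          linear_combination h a * u b * hsymm a b
      _ = _ := by
          rw [Finset.sum_comm, Finset.mul_sum]
          refine Finset.sum_congr rfl fun b _ => ?_
          rw [← Finset.mul_sum, hPh]
          ring
  have hleft : ∑ a : Fin (K + 1), r ^ (a : ℕ) * h a * (∑ b, carrierMatrix p K a b * u b) =
      κ * ∑ a : Fin (K + 1), r ^ (a : ℕ) * h a * u a + h 0 * ((1 - p) * u 0) := by
    simp only [hPu, mul_add, Finset.sum_add_distrib, Finset.mul_sum]
    congr 1
    · exact Finset.sum_congr rfl fun a _ => by ring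
    · rw [Finset.sum_eq_single 0]
      · simp
      · intro a _ ha
        rw [if_neg, mul_zero]
        exact fun h' => ha (Fin.ext h')
      · simp
  have hsum : 0 < ∑ a : Fin (K + 1), r ^ (a : ℕ) * h a * u a :=
    Finset.sum_pos (fun a _ => mul_pos (mul_pos (pow_pos hr0 _) (hh.1 a)) (hpos a (by omega)))
      Finset.univ_nonempty
  have h0 : 0 < h 0 * ((1 - p) * u 0) := mul_pos (hh.1 0) (mul_pos hq (hpos 0 K.zero_le))
  rw [hleft] at hpair
  by_contra! hle
  nlinarith [mul_le_mul_of_nonneg_right hle hsum.le]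

omit hh in
/-- The explicit positive eigenfunction of the carrier killed when it stays at zero. -/
lemma exists_killed_eigenfunction : ∃ (u : ℕ → ℝ) (κ : ℝ), 0 ≤ κ ∧ u (K + 1) = 0 ∧
    (∀ n, p * u (n + 1) + (1 - p) * (if n = 0 then 0 else u (n - 1)) = κ * u n) ∧
    ∀ n ≤ K, 0 < u n := by
  have hq : 0 < 1 - p := by linarith
  obtain ⟨x, hx, hx2⟩ : ∃ x : ℝ, 0 < x ∧ x ^ 2 = p := ⟨_, Real.sqrt_pos.2 hp0, Real.sq_sqrt hp0.le⟩
  obtain ⟨y, hy, hy2⟩ : ∃ x : ℝ, 0 < x ∧ x ^ 2 = 1 - p :=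
    ⟨_, Real.sqrt_pos.2 hq, Real.sq_sqrt hq.le⟩
  set φ : ℝ := Real.pi / (K + 2) with hφ
  have hK : (0 : ℝ) < K + 2 := by positivity
  have hφ0 : 0 < φ := div_pos Real.pi_pos hK
  have hφK : φ * (K + 2) = Real.pi := div_mul_cancel₀ _ hK.ne'
  -- The factor `(y / x) ^ n` symmetrises the walk, and the sine has its zeros at the killing sites
  -- `-1` and `K + 1`.
  refine ⟨fun n => (y / x) ^ n * Real.sin (φ * (n + 1)), 2 * (x * y) * Real.cos φ, ?_, ?_, ?_, ?_⟩
  · have : 0 ≤ Real.cos φ := by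
      refine Real.cos_nonneg_of_neg_pi_div_two_le_of_le (by linarith [Real.pi_pos]) ?_
      rw [hφ]
      exact div_le_div_of_nonneg_left Real.pi_pos.le two_pos (by linarith [K.cast_nonneg (α := ℝ)])
    positivity
  · have : φ * (((K + 1 : ℕ) : ℝ) + 1) = Real.pi := by
      rw [← hφK]; push_cast; ring
    simp only [this, Real.sin_pi, mul_zero]
  · intro n
    have hsin : Real.sin (φ * ((n + 1 : ℕ) + 1)) + Real.sin (φ * n) =
        2 * Real.cos φ * Real.sin (φ * (n + 1)) := by
      have e1 : φ * (((n + 1 : ℕ) : ℝ) + 1) = φ * (n + 1) + φ := by push_cast; ring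
      have e2 : φ * (n : ℝ) = φ * (n + 1) - φ := by ring
      rw [e1, e2, Real.sin_add, Real.sin_sub]
      ring
    rw [← hy2, ← hx2]
    cases n with
    | zero =>
      simp only [if_true, Nat.cast_zero, mul_zero, Real.sin_zero, add_zero] at hsin ⊢
      rw [hsin, zero_add, pow_one, pow_zero]
      field_simp
    | succ n =>
      rw [if_neg (Nat.succ_ne_zero n), Nat.add_sub_cancel]
      have e : φ * ((n : ℝ) + 1) = φ * ((n + 1 : ℕ) : ℝ) := by push_cast; ring
      simp only [e]
      have hs := eq_sub_of_add_eq hsin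
      obtain ⟨r, hr⟩ : ∃ r, y / x = r := ⟨_, rfl⟩
      have hy' : y = x * r := by rw [← hr, mul_div_cancel₀ _ hx.ne']
      rw [hs, hr]
      generalize Real.sin (φ * (((n + 1 : ℕ) : ℝ) + 1)) = s₁
      generalize Real.sin (φ * ((n + 1 : ℕ) : ℝ)) = s₀
      linear_combination ((y + x * r) * r ^ n * s₀ - 2 * x * Real.cos φ * r ^ (n + 1) * s₁) * hy'
  · intro n hn
    refine mul_pos (pow_pos (div_pos hy hx) n) (Real.sin_pos_of_pos_of_lt_pi (by positivity) ?_)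
    rw [← hφK]
    have : (n : ℝ) ≤ K := by exact_mod_cast hn
    exact mul_lt_mul_of_pos_left (by linarith) hφ0

lemma tendsto_gibbsLaw_boundedParam {π : Fin (K + 1) → ℝ}
    (hπ : ∀ a b, Tendsto (fun n => (transformedCarrierMatrix p K h ^ n) a b) atTop (𝓝 (π b)))
    {μ : ProbabilityMeasure (ℤ → Fin 2)}
    (hμ : ∀ m l, (μ : Measure (ℤ → Fin 2)).real (cyl m l) = ∑ b,
      (π ᵥ* wordProd (outputMatrix (transformedCarrierMatrix p K h) (carrierOut K)) l) b) :
    Tendsto (fun N : ℕ+ => gibbsLaw (boundedParam p K) N) atTop (𝓝 μ) := by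
  have hq : 0 < 1 - p := by linarith
  have hΛ := hh.eigenvalue_pos hp0 hp1
  obtain ⟨u, κ, hκ, hu, hstep, hpos⟩ := exists_killed_eigenfunction (K := K) hp0 hp1
  have hlt := lt_carrierEigenvalue hp0 hp1 hh hu hstep hpos
  have hgap := sub_pos.2 hlt
  -- As `θ` grows, the bound `κ + (1 - p) / θ` falls to `κ`, which is below the carrier eigenvalue;
  -- this `θ` already makes `(1 - p) / θ` smaller than the gap.
  set θ : ℝ := 1 + (1 - p) / (carrierEigenvalue p K - κ) with hθ
  have hθ1 : 1 < θ := by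
    have := div_pos hq hgap
    linarith
  have hθ0 : 0 < θ := by linarith
  have hθgap : (1 - p) / θ < carrierEigenvalue p K - κ := by
    rw [div_lt_iff₀ hθ0, hθ, mul_add, mul_div_cancel₀ _ hgap.ne']
    linarith
  exact tendsto_gibbsLaw (transformedCarrierMatrix_nonneg hp0 hp1 hh)
    (transformedCarrierMatrix_sum hp0 hp1 hh) hπ (fun N => pow_pos (div_pos hΛ hq) (N : ℕ))
    (gibbsWeight_boundedParam hp0 hp1 hh) hθ1.le
    (ρ := (κ + (1 - p) / θ) / carrierEigenvalue p K) (by positivity)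
    ((div_lt_one hΛ).2 (by linarith))
    (fun a => div_pos (mul_pos (inv_pos.2 (pow_pos hθ0 _)) (hpos a (by omega))) (hh.1 a))
    (tilted_mulVec_le hp0 hp1 hh hu hstep hpos hθ0) hμ

end bounded

/-! ### Existence and convergence for the Markov and bounded soliton laws. -/

theorem markov_configuration {p₀ p₁ : ℝ} (hp₀ : 0 < p₀) (hp₀' : p₀ < 1) (hp₁ : 0 < p₁)
    (hp₁' : p₁ < 1) (hp : p₀ + p₁ < 1) :
    (∃ μ, IsStationaryMarkovLaw (markovMatrix p₀ p₁) μ) ∧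
      ∀ μ, IsStationaryMarkovLaw (markovMatrix p₀ p₁) μ →
        Tendsto (fun N : ℕ+ => gibbsLaw (markovParam p₀ p₁) N) atTop (𝓝 μ) := by
  have hpos := markovMatrix_pos hp₀ hp₀' hp₁ hp₁'
  have h0 := fun a b => (hpos a b).le
  obtain ⟨π, hπ⟩ := tendsto_pow_of_stochastic (m := 1) h0 markovMatrix_sum (by simpa using hpos)
  refine ⟨exists_isStationaryMarkovLaw h0 markovMatrix_sum hπ, fun μ hμ => ?_⟩
  refine tendsto_gibbsLaw_markovParam hp₀ hp₀' hp₁ hp₁' hp hπ fun m l => ?_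
  rw [← hμ.map_outputPath_cyl markovMatrix_sum hπ]
  -- The output is the state itself, so the output path is the identity map.
  exact congrArg (fun ν : Measure (ℤ → Fin 2) => ν.real (cyl m l)) Measure.map_id.symm

theorem bounded_soliton_configuration {p : ℝ} {K : ℕ} (hp0 : 0 < p) (hp1 : p < 1) :
    (∃ μ, IsBoundedSolitonLaw p K μ) ∧ ∀ μ, IsBoundedSolitonLaw p K μ →
      Tendsto (fun N : ℕ+ => gibbsLaw (boundedParam p K) N) atTop (𝓝 μ) := by
  constructor
  · obtain ⟨h, hh⟩ := exists_isCarrierEigenvector (K := K) hp0 hp1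
    obtain ⟨π, hπ⟩ := exists_tendsto_transformedCarrierMatrix_pow hp0 hp1 hh
    obtain ⟨ν, hν⟩ := exists_isStationaryMarkovLaw (transformedCarrierMatrix_nonneg hp0 hp1 hh)
      (transformedCarrierMatrix_sum hp0 hp1 hh) hπ
    exact ⟨ν.map (measurable_outputPath (carrierOut K)).aemeasurable, h, hh, ν, hν, rfl⟩
  · rintro μ ⟨h, hh, ν, hν, hμ⟩
    obtain ⟨π, hπ⟩ := exists_tendsto_transformedCarrierMatrix_pow hp0 hp1 hh
    refine tendsto_gibbsLaw_boundedParam hp0 hp1 hh hπ fun m l => ?_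
    rw [hμ, ← hν.map_outputPath_cyl (transformedCarrierMatrix_sum hp0 hp1 hh) hπ]
    rfl

end

end BoxBall

theorem mainTheorem2 :
    (∀ p : unitInterval, 0 < (p : ℝ) → (p : ℝ) < 1 / 2 →
      Tendsto (fun N : ℕ+ => BoxBall.gibbsLaw (BoxBall.iidParam p) N) atTop
        (𝓝 (BoxBall.iidLaw p))) ∧
    (∀ p₀ p₁ : ℝ, 0 < p₀ → p₀ < 1 → 0 < p₁ → p₁ < 1 → p₀ + p₁ < 1 →
      (∃ μ, BoxBall.IsStationaryMarkovLaw (BoxBall.markovMatrix p₀ p₁) μ) ∧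
      ∀ μ, BoxBall.IsStationaryMarkovLaw (BoxBall.markovMatrix p₀ p₁) μ →
        Tendsto (fun N : ℕ+ => BoxBall.gibbsLaw (BoxBall.markovParam p₀ p₁) N) atTop (𝓝 μ)) ∧
    (∀ (p : ℝ) (K : ℕ), 0 < p → p < 1 → 1 ≤ K →
      (∃ μ, BoxBall.IsBoundedSolitonLaw p K μ) ∧
      ∀ μ, BoxBall.IsBoundedSolitonLaw p K μ →
        Tendsto (fun N : ℕ+ => BoxBall.gibbsLaw (BoxBall.boundedParam p K) N) atTop (𝓝 μ)) := by
  exact ⟨BoxBall.tendsto_gibbsLaw_iidParam,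
    fun _ _ hp₀ hp₀' hp₁ hp₁' hp => BoxBall.markov_configuration hp₀ hp₀' hp₁ hp₁' hp,
    fun _ _ hp0 hp1 _ => BoxBall.bounded_soliton_configuration hp0 hp1⟩
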